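/- Let $w$ be one of the four Chebyshev weights on $(-1,1)$, \[ w_1(x)=\frac1{\sqrt{1-x^2}},\quad w_2(x)=\sqrt{1-x^2},\quad w_3(x)=\sqrt{\frac{1+x}{1-x}},\quad w_4(x)=\sqrt{\frac{1-x}{1+x}}, \] let $\{p_j\}_{j\ge 0}$ be the polynomials, with $\deg p_j=j$ and positive leading coefficients, that are orthonormal with respect to $\int_{-1}^1 p\,q\,w\,dx$, let $x_1,\dots,x_n$ be the zeros of $p_n$, and let $\lambda_{n,k}=\bigl(\sum_{j=0}^{n}p_j(x_k)^2\bigr)^{-1}$ be the Christoffel numbers. For integers $0<m<n$ and a function $f$ on $(-1,1)$, the de la Vallée Poussin interpolating polynomial of $f$ is \[ V_n^mf(x)=\sum_{k=1}^n f(x_k)\,\lambda_{n,k}\sum_{j=0}^{n+m-1}\mu_{n,j}^m\,p_j(x)\,p_j(x_k),\qquad \mu_{n,j}^m=\begin{cases}1,&0\le j\le n-m,\\[2pt] \dfrac{n+m-j}{2m},& n-m<j<n+m.\end{cases} \] Let $u(x)=(1-x)^\gamma(1+x)^\delta$ with $\gamma,\delta\ge 0$ (with $0^0=1$), write $\|g\|=\sup_{|x|\le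 1}|g(x)|$, and define the weighted Lebesgue constant \[ \|V_n^m\|_u=\sup_{f\ne 0}\frac{\|(V_n^mf)u\|}{\|fu\|}, \] where $f$ ranges over the functions, not identically zero on $(-1,1)$, with $\|fu\|<\infty$ and $f(x)u(x)\to0$ as $x\to1^-$ (respectively $x\to-1^+$) whenever $u(1)=0$ (respectively $u(-1)=0$); at an end-point where $u$ vanishes, $fu$ is given the value $0$, and at an end-point where $u$ does not vanish $f$ is also assumed to be defined. Then, for every fixed constant $C>1$, \[ \sup\bigl\{\|V_n^m\|_u:\ m,n\in\mathbb N,\ m<n\le Cm\bigr\}<\infty \] if and only if \begin{itemize} \item in the case $w=w_1$: $0\le\gamma\le1$ and $0\le\delta\le1$; \item in the case $w=w_2$: $0<\gamma\le\frac32$, $0<\delta\le\frac32$ and $-1\le\gamma-\delta\le1$; \item in the case $w=w_3$: $0\le\gamma\le1$, $0<\delta\le\frac32$ and $\gamma-\delta\le\frac12$; \item in the case $w=w_4$: $0<\gamma\le\frac32$, $0\le\delta\le1$ and $\gamma-\delta\ge-\frac12$. \end{itemize} -/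

import Mathlib

open scoped ENNReal Topology Polynomial

noncomputable section

/-- The Chebyshev weight of the first kind, `1 / √(1 - x²)` on `(-1, 1)`. -/
def chebW1 (x : ℝ) : ℝ := 1 / √(1 - x ^ 2)

/-- The Chebyshev weight of the second kind, `√(1 - x²)`. -/
def chebW2 (x : ℝ) : ℝ := √(1 - x ^ 2)

/-- The Chebyshev weight of the third kind, `√((1 + x) / (1 - x))`. -/
def chebW3 (x : ℝ) : ℝ := √((1 + x) / (1 - x))

/-- The Chebyshev weight of the fourth kind, `√((1 - x) / (1 + x))`. -/
def chebW4 (x : ℝ) : ℝ := √((1 - x) / (1 + x))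

/-- The inner product `∫_{-1}^{1} p(x) q(x) w(x) dx` of two polynomials. -/
def wInner (w : ℝ → ℝ) (p q : ℝ[X]) : ℝ :=
  ∫ x in (-1 : ℝ)..1, p.eval x * q.eval x * w x

/-- The orthonormal polynomials `p_n(w)` with positive leading coefficients, obtained from the
monomials by the Gram-Schmidt process for the inner product with weight `w`. -/
def orthoPoly (w : ℝ → ℝ) (n : ℕ) : ℝ[X] :=
  let q : ℝ[X] := Polynomial.X ^ n -
    ∑ j : Fin n, wInner w (Polynomial.X ^ n) (orthoPoly w j) • orthoPoly w j
  (√(wInner w q q))⁻¹ • q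
termination_by n
decreasing_by all_goals exact j.2

/-- The interpolation nodes: the zeros of `p_n(w)`. -/
def nodes (w : ℝ → ℝ) (n : ℕ) : Finset ℝ := (orthoPoly w n).roots.toFinset

/-- The Christoffel number of a node `z` of order `n`
(`p_n(w)` vanishes at `z`, so the term `j = n` does not contribute). -/
def christoffel (w : ℝ → ℝ) (n : ℕ) (z : ℝ) : ℝ :=
  1 / ∑ j ∈ Finset.range (n + 1), (orthoPoly w j).eval z ^ 2

/-- The de la Vallée Poussin filter coefficient `μ_{n,j}^m`, used for `0 ≤ j < n + m`. -/
def vpFilter (n m j : ℕ) : ℝ :=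
  if j + m ≤ n then 1 else ((n : ℝ) + m - j) / (2 * m)

/-- The fundamental de la Vallée Poussin polynomial attached to the node `z`, evaluated at `x`. -/
def vpFundamental (w : ℝ → ℝ) (n m : ℕ) (z x : ℝ) : ℝ :=
  christoffel w n z *
    ∑ j ∈ Finset.range (n + m),
      vpFilter n m j * (orthoPoly w j).eval x * (orthoPoly w j).eval z

/-- The filtered interpolating polynomial `V_n^m f`, evaluated at `x`. -/
def vpInterp (w : ℝ → ℝ) (n m : ℕ) (f : ℝ → ℝ) (x : ℝ) : ℝ :=
  ∑ z ∈ nodes w n, f z * vpFundamental w n m z x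

/-- The Jacobi weight `(1 - x)^γ (1 + x)^δ` on `[-1, 1]`, with `0 ^ 0 = 1`. -/
def jacobiWeight (γ δ : ℝ) (x : ℝ) : ℝ := (1 - x) ^ γ * (1 + x) ^ δ

/-- The supremum norm over `[-1, 1]`, with values in `[0, ∞]`. -/
def supNorm (g : ℝ → ℝ) : ℝ≥0∞ := ⨆ x ∈ Set.Icc (-1 : ℝ) 1, ENNReal.ofReal |g x|

/-- The admissible functions for the weight `u`: `f u` tends to `0` at each of the end-points
at which `u` vanishes. Only the values of `f` on `[-1, 1]` matter, and the value at an end-point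
matters only if `u` does not vanish there. -/
def Admissible (u f : ℝ → ℝ) : Prop :=
  (u 1 = 0 → Filter.Tendsto (fun x => f x * u x) (𝓝[<] 1) (𝓝 0)) ∧
  (u (-1) = 0 → Filter.Tendsto (fun x => f x * u x) (𝓝[>] (-1)) (𝓝 0))

/-- The weighted Lebesgue constant of `V_n^m`: the supremum of `‖(V_n^m f) u‖ / ‖f u‖` over the
admissible functions that do not vanish identically on `(-1, 1)`. An `f` for which `f u` is
unbounded contributes `0`. -/
def lebesgueConst (w u : ℝ → ℝ) (n m : ℕ) : ℝ≥0∞ :=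
  ⨆ (f : ℝ → ℝ) (_ : Admissible u f) (_ : ∃ x ∈ Set.Ioo (-1 : ℝ) 1, f x ≠ 0),
    supNorm (fun x => vpInterp w n m f x * u x) / supNorm (fun x => f x * u x)

/-- The supremum of the weighted Lebesgue constants over all `n, m` with `m < n ≤ c m`. -/
def supLebesgueConst (w u : ℝ → ℝ) (c : ℝ) : ℝ≥0∞ :=
  ⨆ (n : ℕ) (m : ℕ) (_ : m < n) (_ : (n : ℝ) ≤ c * m), lebesgueConst w u n m

end

open Real Polynomial Set

/-- The frequency `n + (α + β) / 2` of the `n`-th Chebyshev function. -/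
noncomputable def chebFreq (α β n : ℕ) : ℝ := n + ((α : ℝ) + β) / 2

/-- The trigonometric function `cos (N t - α π / 2)`. -/
noncomputable def chebTrig (α β n : ℕ) (t : ℝ) : ℝ := cos (chebFreq α β n * t - α * (π / 2))

/-- The square root of the weight in the variable `t = arccos x`. -/
noncomputable def chebRoot (α β : ℕ) (t : ℝ) : ℝ := (√2 * sin (t / 2)) ^ α * (√2 * cos (t / 2)) ^ β

/-- The normalization `1 / 2` for the constant function, and `1` otherwise. -/
noncomputable def chebHalf (α β n : ℕ) : ℝ := if n + α + β = 0 then 1 / 2 else 1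

/-- `P` is the sequence of Chebyshev polynomials for the weight `w`, of the kind given by
`α, β ∈ {0, 1}`. -/
structure IsChebSystem (α β : ℕ) (w : ℝ → ℝ) (P : ℕ → ℝ[X]) : Prop where
  alpha_le : α ≤ 1
  beta_le : β ≤ 1
  weight : ∀ t ∈ Ioo 0 π, w (cos t) * sin t = chebRoot α β t ^ 2
  natDegree_eq : ∀ j, (P j).natDegree = j
  leadingCoeff_pos : ∀ j, 0 < (P j).leadingCoeff
  eval_cos : ∀ j, ∀ t ∈ Ioo 0 π,
    (P j).eval (cos t) * chebRoot α β t = √(2 / π * chebHalf α β j) * chebTrig α β j t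

theorem sin_half_pos {t : ℝ} (ht : t ∈ Ioo 0 π) : 0 < sin (t / 2) :=
  sin_pos_of_pos_of_lt_pi (by linarith [ht.1]) (by linarith [ht.2, pi_pos])

theorem cos_half_pos {t : ℝ} (ht : t ∈ Ioo 0 π) : 0 < cos (t / 2) :=
  cos_pos_of_mem_Ioo ⟨by linarith [ht.1, pi_pos], by linarith [ht.2]⟩

theorem chebRoot_pos (α β : ℕ) {t : ℝ} (ht : t ∈ Ioo 0 π) : 0 < chebRoot α β t := by
  have := sin_half_pos ht
  have := cos_half_pos ht
  unfold chebRoot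
  positivity

theorem cos_image_Ioo : cos '' Ioo 0 π = Ioo (-1) 1 := by
  ext x
  constructor
  · rintro ⟨t, ht, rfl⟩
    constructor
    · have := cos_lt_cos_of_nonneg_of_le_pi ht.1.le le_rfl ht.2
      rwa [cos_pi] at this
    · have := cos_lt_cos_of_nonneg_of_le_pi le_rfl ht.2.le ht.1
      rwa [cos_zero] at this
  · intro hx
    refine ⟨arccos x, ⟨arccos_pos.2 hx.2, ?_⟩, cos_arccos hx.1.le hx.2.le⟩
    refine lt_of_le_of_ne (arccos_le_pi x) fun h => ?_
    rw [arccos_eq_pi] at h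
    linarith [hx.1]

theorem integral_comp_cos (g : ℝ → ℝ) :
    ∫ x in (-1 : ℝ)..1, g x = ∫ t in (0 : ℝ)..π, g (cos t) * sin t := by
  rw [intervalIntegral.integral_of_le (by norm_num), intervalIntegral.integral_of_le pi_pos.le,
    MeasureTheory.integral_Ioc_eq_integral_Ioo, MeasureTheory.integral_Ioc_eq_integral_Ioo,
    ← cos_image_Ioo, MeasureTheory.integral_image_eq_integral_abs_deriv_smul measurableSet_Ioo
      (fun x _ => (hasDerivAt_cos x).hasDerivWithinAt)
      (injOn_cos.mono Ioo_subset_Icc_self)]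
  refine MeasureTheory.setIntegral_congr_fun measurableSet_Ioo fun t ht => ?_
  simp only [abs_neg, smul_eq_mul]
  rw [abs_of_pos (sin_pos_of_pos_of_lt_pi ht.1 ht.2), mul_comm]

theorem integral_cos_int_mul (k : ℤ) :
    ∫ t in (0 : ℝ)..π, cos (k * t) = if k = 0 then π else 0 := by
  split_ifs with h
  · simp [h]
  · have hk : (k : ℝ) ≠ 0 := by exact_mod_cast h
    rw [intervalIntegral.integral_comp_mul_left (fun x => cos x) hk, integral_cos]
    simp [sin_int_mul_pi]

theorem chebTrig_mul_chebTrig (α β i j : ℕ) (t y : ℝ) :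
    chebTrig α β i t * chebTrig α β j y =
      (cos (chebFreq α β i * t - chebFreq α β j * y) +
        (-1) ^ α * cos (chebFreq α β i * t + chebFreq α β j * y)) / 2 := by
  have h : (-1) ^ α * cos (chebFreq α β i * t + chebFreq α β j * y) =
      cos (chebFreq α β i * t + chebFreq α β j * y - α * π) := by
    rw [cos_sub_nat_mul_pi]
  rw [h, cos_add_cos]
  unfold chebTrig
  rw [show ∀ a b : ℝ, 2 * a * b / 2 = a * b by intros; ring, ← cos_neg ((_ - _) / 2)]
  congr 2 <;> ring

theorem integral_chebTrig_mul {α β : ℕ} (i j : ℕ) :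
    ∫ t in (0 : ℝ)..π, chebTrig α β i t * chebTrig α β j t =
      if i = j then π / 2 / chebHalf α β i else 0 := by
  have h : ∀ t, chebTrig α β i t * chebTrig α β j t =
      (1 / 2) * cos (((i - j : ℤ) : ℝ) * t) +
        ((-1) ^ α / 2) * cos (((i + j + α + β : ℤ) : ℝ) * t) := by
    intro t
    rw [chebTrig_mul_chebTrig]
    unfold chebFreq
    push_cast
    rw [show ((i : ℝ) + (α + β) / 2) * t - (j + (α + β) / 2) * t = (i - j) * t by ring,
      show ((i : ℝ) + (α + β) / 2) * t + (j + (α + β) / 2) * t = (i + j + α + β) * t by ring]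
    ring
  simp_rw [h]
  rw [intervalIntegral.integral_add ((by fun_prop : Continuous _).intervalIntegrable _ _)
    ((by fun_prop : Continuous _).intervalIntegrable _ _),
    intervalIntegral.integral_const_mul, intervalIntegral.integral_const_mul,
    integral_cos_int_mul, integral_cos_int_mul]
  unfold chebHalf
  by_cases hij : i = j
  · subst hij
    by_cases h0 : i + α + β = 0
    · obtain ⟨⟨rfl, rfl⟩, rfl⟩ : (i = 0 ∧ α = 0) ∧ β = 0 := by simpa using h0
      simp
      ring
    · rw [if_neg h0]
      rw [if_neg (show ¬ ((i : ℤ) + i + α + β = 0) by omega)]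
      simp
      ring
  · rw [if_neg (by omega), if_neg (by omega), if_neg hij]
    simp

section
variable {α β : ℕ} {w : ℝ → ℝ} {P : ℕ → ℝ[X]}

theorem IsChebSystem.wInner_eq (h : IsChebSystem α β w P) (p q : ℝ[X]) :
    wInner w p q = ∫ t in (0 : ℝ)..π, p.eval (cos t) * q.eval (cos t) * chebRoot α β t ^ 2 := by
  unfold wInner
  rw [integral_comp_cos, intervalIntegral.integral_of_le pi_pos.le,
    intervalIntegral.integral_of_le pi_pos.le,
    MeasureTheory.integral_Ioc_eq_integral_Ioo, MeasureTheory.integral_Ioc_eq_integral_Ioo]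
  refine MeasureTheory.setIntegral_congr_fun measurableSet_Ioo fun t ht => ?_
  rw [← h.weight t ht]
  ring

theorem continuous_chebRoot (α β : ℕ) : Continuous (chebRoot α β) := by
  unfold chebRoot
  fun_prop

theorem IsChebSystem.wInner_linear (h : IsChebSystem α β w P) (a : ℝ) (p q r : ℝ[X]) :
    wInner w (p + a • q) r = wInner w p r + a * wInner w q r := by
  have hc := continuous_chebRoot α β
  rw [h.wInner_eq, h.wInner_eq, h.wInner_eq, ← intervalIntegral.integral_const_mul,
    ← intervalIntegral.integral_add]
  · congr 1
    ext t
    simp only [eval_add, eval_smul, smul_eq_mul]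
    ring
  · exact (((p.continuous.comp continuous_cos).mul (r.continuous.comp continuous_cos)).mul
      (hc.pow 2)).intervalIntegrable _ _
  · exact (continuous_const.mul (((q.continuous.comp continuous_cos).mul
      (r.continuous.comp continuous_cos)).mul (hc.pow 2))).intervalIntegrable _ _

theorem IsChebSystem.wInner_smul_left (h : IsChebSystem α β w P) (a : ℝ) (q r : ℝ[X]) :
    wInner w (a • q) r = a * wInner w q r := by
  have := h.wInner_linear a 0 q r
  rw [zero_add] at this
  rw [this, add_eq_right]
  simp [wInner]

theorem IsChebSystem.wInner_sum_left (h : IsChebSystem α β w P) (c : ℕ → ℝ) (n : ℕ)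
    (r : ℝ[X]) :
    wInner w (∑ j ∈ Finset.range n, c j • P j) r =
      ∑ j ∈ Finset.range n, c j * wInner w (P j) r := by
  induction n with
  | zero => simp [wInner]
  | succ n ih => rw [Finset.sum_range_succ, h.wInner_linear, ih, Finset.sum_range_succ]

theorem chebHalf_pos (α β n : ℕ) : 0 < chebHalf α β n := by
  unfold chebHalf
  split_ifs <;> norm_num

theorem IsChebSystem.wInner_orthonormal (h : IsChebSystem α β w P) (i j : ℕ) :
    wInner w (P i) (P j) = if i = j then 1 else 0 := by
  have key : ∀ t ∈ Ioo 0 π, (P i).eval (cos t) * (P j).eval (cos t) * chebRoot α β t ^ 2 =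
      √(2 / π * chebHalf α β i) * √(2 / π * chebHalf α β j) *
        (chebTrig α β i t * chebTrig α β j t) := by
    intro t ht
    rw [show ∀ a b c : ℝ, a * b * c ^ 2 = (a * c) * (b * c) by intros; ring,
      h.eval_cos i t ht, h.eval_cos j t ht]
    ring
  rw [h.wInner_eq]
  have : ∫ t in (0 : ℝ)..π, (P i).eval (cos t) * (P j).eval (cos t) * chebRoot α β t ^ 2 =
      ∫ t in (0 : ℝ)..π, √(2 / π * chebHalf α β i) * √(2 / π * chebHalf α β j) *
        (chebTrig α β i t * chebTrig α β j t) := by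
    rw [intervalIntegral.integral_of_le pi_pos.le, intervalIntegral.integral_of_le pi_pos.le,
      MeasureTheory.integral_Ioc_eq_integral_Ioo, MeasureTheory.integral_Ioc_eq_integral_Ioo]
    exact MeasureTheory.setIntegral_congr_fun measurableSet_Ioo key
  rw [this, intervalIntegral.integral_const_mul, integral_chebTrig_mul]
  split_ifs with hij
  · subst hij
    have := chebHalf_pos α β i
    rw [mul_self_sqrt (by positivity)]
    have := pi_pos
    field_simp
  · simp

theorem IsChebSystem.eq_sum (h : IsChebSystem α β w P) (n : ℕ) :
    ∀ p : ℝ[X], p.degree < n → ∃ c : ℕ → ℝ, p = ∑ j ∈ Finset.range n, c j • P j := by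
  induction n with
  | zero =>
    intro p hp
    refine ⟨0, ?_⟩
    simpa using hp
  | succ n ih =>
    intro p hp
    have hl := (h.leadingCoeff_pos n).ne'
    have hn : (P n).coeff n = (P n).leadingCoeff := by rw [leadingCoeff, h.natDegree_eq]
    have hd : (p - (p.coeff n / (P n).leadingCoeff) • P n).degree < n := by
      rw [degree_lt_iff_coeff_zero] at hp ⊢
      intro k hk
      rcases hk.eq_or_lt with rfl | hk
      · rw [coeff_sub, coeff_smul, hn, smul_eq_mul, div_mul_cancel₀ _ hl, sub_self]
      · rw [coeff_sub, coeff_smul, hp k hk, coeff_eq_zero_of_natDegree_lt (p := P n)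
          (by rwa [h.natDegree_eq])]
        simp
    obtain ⟨c, hc⟩ := ih _ hd
    refine ⟨fun j => if j = n then p.coeff n / (P n).leadingCoeff else c j, ?_⟩
    simp only [Finset.sum_range_succ, if_true]
    rw [← sub_eq_iff_eq_add, hc]
    refine Finset.sum_congr rfl fun j hj => ?_
    rw [if_neg (Finset.mem_range.1 hj).ne]

theorem IsChebSystem.orthoPoly_eq (h : IsChebSystem α β w P) (n : ℕ) : orthoPoly w n = P n := by
  induction n using Nat.strong_induction_on with
  | _ n ih =>
    rw [orthoPoly]
    have h1 : ∑ j : Fin n, wInner w (Polynomial.X ^ n) (orthoPoly w j) • orthoPoly w j =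
        ∑ j ∈ Finset.range n, wInner w (Polynomial.X ^ n) (P j) • P j := by
      rw [← Fin.sum_univ_eq_sum_range (fun j => wInner w (Polynomial.X ^ n) (P j) • P j)]
      exact Finset.sum_congr rfl fun j _ => by rw [ih j j.2]
    obtain ⟨c, hc⟩ := h.eq_sum (n + 1) (Polynomial.X ^ n) (by
      rw [degree_X_pow]; exact_mod_cast n.lt_succ_self)
    have hcj : ∀ j < n + 1, wInner w (Polynomial.X ^ n) (P j) = c j := by
      intro j hj
      rw [hc, h.wInner_sum_left]
      simp_rw [h.wInner_orthonormal]
      simp [Finset.mem_range.2 hj]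
    have h2 : (Polynomial.X ^ n : ℝ[X]) -
        ∑ j ∈ Finset.range n, wInner w (Polynomial.X ^ n) (P j) • P j = c n • P n := by
      rw [sub_eq_iff_eq_add]
      conv_lhs => rw [hc, Finset.sum_range_succ, add_comm]
      congr 1
      refine Finset.sum_congr rfl fun j hj => ?_
      rw [hcj j (by have := Finset.mem_range.1 hj; omega)]
    have hpos : 0 < c n := by
      have h3 := congrArg (fun p => p.coeff n) hc
      simp only [coeff_X_pow_self, Finset.sum_range_succ, coeff_add, finsetSum_coeff,
        coeff_smul] at h3
      rw [Finset.sum_eq_zero, zero_add, smul_eq_mul] at h3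
      · have h4 : (P n).coeff n = (P n).leadingCoeff := by rw [leadingCoeff, h.natDegree_eq]
        rw [h4] at h3
        have := h.leadingCoeff_pos n
        exact pos_of_mul_pos_left (h3 ▸ one_pos) this.le
      · intro j hj
        rw [coeff_eq_zero_of_natDegree_lt (by rw [h.natDegree_eq]; exact Finset.mem_range.1 hj)]
        simp
    have h5 : wInner w (c n • P n) (c n • P n) = c n ^ 2 := by
      rw [h.wInner_smul_left]
      have : wInner w (P n) (c n • P n) = wInner w (c n • P n) (P n) := by
        unfold wInner
        congr 1
        ext x
        ring
      rw [this, h.wInner_smul_left, h.wInner_orthonormal]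
      simp
      ring
    simp only [h1, h2, h5]
    rw [sqrt_sq hpos.le, smul_smul, inv_mul_cancel₀ hpos.ne', one_smul]

end

theorem isChebSystem_of_eval {α β : ℕ} {w : ℝ → ℝ} {Q : ℕ → ℝ[X]} {d : ℝ} (hα : α ≤ 1)
    (hβ : β ≤ 1) (hd : 0 < d) (hw : ∀ t ∈ Ioo 0 π, w (cos t) * sin t = chebRoot α β t ^ 2)
    (hQ : ∀ j, (Q j).natDegree = j) (hl : ∀ j, 0 < (Q j).leadingCoeff)
    (he : ∀ j : ℕ, ∀ t ∈ Ioo 0 π,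
      (Q j).eval (cos t) * chebRoot α β t = d * chebTrig α β j t) :
    IsChebSystem α β w fun j => (√(2 / π * chebHalf α β j) / d) • Q j := by
  have hc : ∀ j, 0 < √(2 / π * chebHalf α β j) / d := fun j => by
    have := chebHalf_pos α β j
    have := pi_pos
    positivity
  refine ⟨hα, hβ, hw, fun j => ?_, fun j => ?_, fun j t ht => ?_⟩
  · rw [natDegree_smul _ (hc j).ne', hQ]
  · rw [leadingCoeff_smul_of_smul_regular _ (IsSMulRegular.of_ne_zero (hc j).ne')]
    exact smul_pos (hc j) (hl j)
  · rw [eval_smul, smul_eq_mul, mul_assoc, he j t ht]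
    field_simp

theorem one_add_cos_eq (t : ℝ) : 1 + cos t = 2 * cos (t / 2) ^ 2 := by
  have := cos_two_mul (t / 2)
  rw [mul_div_cancel₀ _ two_ne_zero] at this
  linarith

theorem one_sub_cos_eq (t : ℝ) : 1 - cos t = 2 * sin (t / 2) ^ 2 := by
  have := one_add_cos_eq t
  have := sin_sq_add_cos_sq (t / 2)
  linarith

theorem sin_eq_half (t : ℝ) : sin t = 2 * sin (t / 2) * cos (t / 2) := by
  rw [← sin_two_mul, mul_div_cancel₀ _ two_ne_zero]

theorem degree_U_sub_one_lt (j : ℕ) :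
    (Chebyshev.U ℝ ((j : ℤ) - 1)).degree < (Chebyshev.U ℝ j).degree := by
  rw [Chebyshev.degree_U_natCast]
  cases j with
  | zero => simp
  | succ j =>
    rw [show (((j + 1 : ℕ) : ℤ) - 1) = (j : ℤ) by push_cast; ring, Chebyshev.degree_U_natCast]
    exact_mod_cast j.lt_succ_self

theorem exists_isChebSystem_one : ∃ P, IsChebSystem 0 0 chebW1 P := by
  refine ⟨_, isChebSystem_of_eval (Q := fun j => Chebyshev.T ℝ j) (by simp) (by simp) one_pos
    (fun t ht => ?_) (fun j => ?_) (fun j => ?_) (fun j t ht => ?_)⟩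
  · have h := sin_pos_of_pos_of_lt_pi ht.1 ht.2
    rw [chebW1, ← sin_sq, sqrt_sq h.le]
    simp [chebRoot, h.ne']
  · simp [Chebyshev.natDegree_T]
  · rw [Chebyshev.leadingCoeff_T]
    positivity
  · simp [Chebyshev.T_real_cos, chebRoot, chebTrig, chebFreq]

theorem exists_isChebSystem_two : ∃ P, IsChebSystem 1 1 chebW2 P := by
  have hr : ∀ t, chebRoot 1 1 t = sin t := fun t => by
    rw [chebRoot, sin_eq_half t]
    linear_combination sin (t / 2) * cos (t / 2) * mul_self_sqrt (zero_le_two (α := ℝ))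
  refine ⟨_, isChebSystem_of_eval (Q := fun j => Chebyshev.U ℝ j) le_rfl le_rfl one_pos
    (fun t ht => ?_) (fun j => ?_) (fun j => ?_) (fun j t ht => ?_)⟩
  · have h := sin_pos_of_pos_of_lt_pi ht.1 ht.2
    rw [chebW2, ← sin_sq, sqrt_sq h.le, hr, sq]
  · simp [Chebyshev.natDegree_U_natCast]
  · rw [Chebyshev.leadingCoeff_U_natCast]
    positivity
  · rw [hr, Chebyshev.U_real_cos, chebTrig, chebFreq]
    push_cast
    rw [one_mul, one_mul, cos_sub_pi_div_two]
    norm_num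

theorem exists_isChebSystem_three : ∃ P, IsChebSystem 0 1 chebW3 P := by
  have hr : ∀ t, chebRoot 0 1 t = √2 * cos (t / 2) := fun t => by simp [chebRoot]
  have h2 : √2 ^ 2 = (2 : ℝ) := sq_sqrt zero_le_two
  refine ⟨_, isChebSystem_of_eval
    (Q := fun j => Chebyshev.U ℝ j - Chebyshev.U ℝ ((j : ℤ) - 1)) (d := √2) zero_le_one le_rfl
    (by positivity) (fun t ht => ?_) (fun j => ?_) (fun j => ?_) (fun j t ht => ?_)⟩
  · have hs := sin_half_pos ht
    have hc := cos_half_pos ht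
    rw [chebW3, one_add_cos_eq, one_sub_cos_eq, mul_div_mul_left _ _ two_ne_zero, ← div_pow,
      sqrt_sq (by positivity), sin_eq_half t, hr, mul_pow, h2]
    field_simp
  · rw [natDegree_eq_of_degree_eq (degree_sub_eq_left_of_degree_lt (degree_U_sub_one_lt j)),
      Chebyshev.natDegree_U_natCast]
  · rw [leadingCoeff_sub_of_degree_lt (degree_U_sub_one_lt j), Chebyshev.leadingCoeff_U_natCast]
    positivity
  · have hs := sin_half_pos ht
    refine mul_right_cancel₀ (b := 2 * sin (t / 2)) (by positivity) ?_
    have e1 := Chebyshev.U_real_cos t j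
    have e2 := Chebyshev.U_real_cos t ((j : ℤ) - 1)
    rw [sin_eq_half t] at e1 e2
    push_cast at e1 e2
    have e3 : sin ((j + 1) * t) - sin ((j - 1 + 1) * t) =
        2 * sin (t / 2) * chebTrig 0 1 j t := by
      rw [sin_sub_sin, chebTrig, chebFreq]
      push_cast
      congr 3 <;> ring
    rw [hr, eval_sub]
    linear_combination √2 * (e1 - e2 + e3)

theorem exists_isChebSystem_four : ∃ P, IsChebSystem 1 0 chebW4 P := by
  have hr : ∀ t, chebRoot 1 0 t = √2 * sin (t / 2) := fun t => by simp [chebRoot]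
  have h2 : √2 ^ 2 = (2 : ℝ) := sq_sqrt zero_le_two
  refine ⟨_, isChebSystem_of_eval
    (Q := fun j => Chebyshev.U ℝ j + Chebyshev.U ℝ ((j : ℤ) - 1)) (d := √2) le_rfl zero_le_one
    (by positivity) (fun t ht => ?_) (fun j => ?_) (fun j => ?_) (fun j t ht => ?_)⟩
  · have hs := sin_half_pos ht
    have hc := cos_half_pos ht
    rw [chebW4, one_add_cos_eq, one_sub_cos_eq, mul_div_mul_left _ _ two_ne_zero, ← div_pow,
      sqrt_sq (by positivity), sin_eq_half t, hr, mul_pow, h2]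
    field_simp
  · rw [natDegree_add_eq_left_of_degree_lt (degree_U_sub_one_lt j), Chebyshev.natDegree_U_natCast]
  · rw [leadingCoeff_add_of_degree_lt' (degree_U_sub_one_lt j), Chebyshev.leadingCoeff_U_natCast]
    positivity
  · have hc := cos_half_pos ht
    refine mul_right_cancel₀ (b := 2 * cos (t / 2)) (by positivity) ?_
    have e1 := Chebyshev.U_real_cos t j
    have e2 := Chebyshev.U_real_cos t ((j : ℤ) - 1)
    rw [sin_eq_half t] at e1 e2
    push_cast at e1 e2
    have e3 : sin ((j + 1) * t) + sin ((j - 1 + 1) * t) =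
        2 * cos (t / 2) * chebTrig 1 0 j t := by
      rw [sin_add_sin, chebTrig, chebFreq]
      push_cast
      rw [one_mul, cos_sub_pi_div_two]
      rw [mul_right_comm]
      congr 3 <;> ring
    rw [hr, eval_add]
    linear_combination √2 * (e1 + e2 + e3)

/-- The angle of the `k`-th interpolation node. -/
noncomputable def chebNode (α β n k : ℕ) : ℝ := (k + ((α : ℝ) + 1) / 2) * π / chebFreq α β n

theorem chebFreq_pos {α β n : ℕ} (hn : 0 < n) : 0 < chebFreq α β n := by
  unfold chebFreq
  positivity

theorem chebFreq_mul_chebNode {α β n : ℕ} (hn : 0 < n) (k : ℕ) :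
    chebFreq α β n * chebNode α β n k = (k + ((α : ℝ) + 1) / 2) * π := by
  rw [chebNode, mul_div_cancel₀ _ (chebFreq_pos hn).ne']

theorem chebNode_pos {α β n : ℕ} (hn : 0 < n) (k : ℕ) : 0 < chebNode α β n k := by
  have := chebFreq_pos (α := α) (β := β) hn
  have := pi_pos
  unfold chebNode
  positivity

theorem pi_sub_chebNode {α β n k : ℕ} (hk : k < n) :
    π - chebNode α β n k = chebNode β α n (n - 1 - k) := by
  have h1 := chebFreq_pos (α := α) (β := β) (by omega : 0 < n)
  have h2 : chebFreq β α n = chebFreq α β n := by unfold chebFreq; ring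
  have h3 : ((n - 1 - k : ℕ) : ℝ) = n - 1 - k := by
    rw [Nat.cast_sub (by omega), Nat.cast_sub (by omega)]
    simp
  unfold chebNode
  rw [h2, h3, eq_div_iff h1.ne', sub_mul, div_mul_cancel₀ _ h1.ne']
  unfold chebFreq
  ring

theorem chebNode_mem {α β n k : ℕ} (hk : k < n) : chebNode α β n k ∈ Ioo 0 π := by
  refine ⟨chebNode_pos (by omega) k, ?_⟩
  have := chebNode_pos (α := β) (β := α) (by omega : 0 < n) (n - 1 - k)
  rw [← pi_sub_chebNode hk] at this
  linarith

theorem chebNode_injective {α β n : ℕ} (hn : 0 < n) : Function.Injective (chebNode α β n) := by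
  intro k l h
  have h1 := chebFreq_mul_chebNode (α := α) (β := β) hn k
  rw [h, chebFreq_mul_chebNode hn] at h1
  have := mul_right_cancel₀ pi_ne_zero h1
  have : (l : ℝ) = k := by linarith
  exact_mod_cast this.symm

theorem chebTrig_chebNode {α β n : ℕ} (hn : 0 < n) (k : ℕ) :
    chebTrig α β n (chebNode α β n k) = 0 := by
  rw [chebTrig, chebFreq_mul_chebNode hn, cos_eq_zero_iff]
  exact ⟨k, by push_cast; ring⟩

section
variable {α β : ℕ} {w : ℝ → ℝ} {P : ℕ → ℝ[X]}

theorem injOn_cos_chebNode (n : ℕ) :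
    Set.InjOn (fun k => cos (chebNode α β n k)) (Finset.range n) := by
  intro k hk l hl h
  have hk := Finset.mem_range.1 hk
  have hl := Finset.mem_range.1 hl
  exact chebNode_injective (by omega) (injOn_cos (Ioo_subset_Icc_self (chebNode_mem hk))
    (Ioo_subset_Icc_self (chebNode_mem hl)) h)

theorem IsChebSystem.nodes_eq (h : IsChebSystem α β w P) (n : ℕ) :
    nodes w n = (Finset.range n).image fun k => cos (chebNode α β n k) := by
  have h0 : P n ≠ 0 := fun h0 => by simpa [h0] using h.leadingCoeff_pos n
  rw [nodes, h.orthoPoly_eq]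
  symm
  apply Finset.eq_of_subset_of_card_le
  · intro x hx
    obtain ⟨k, hk, rfl⟩ := Finset.mem_image.1 hx
    have hk := Finset.mem_range.1 hk
    rw [Multiset.mem_toFinset, mem_roots h0, IsRoot]
    have := h.eval_cos n _ (chebNode_mem (α := α) (β := β) hk)
    rw [chebTrig_chebNode (by omega), mul_zero] at this
    exact (mul_eq_zero.1 this).resolve_right (chebRoot_pos α β (chebNode_mem hk)).ne'
  · rw [Finset.card_image_of_injOn (injOn_cos_chebNode n), Finset.card_range]
    calc _ ≤ Multiset.card (P n).roots := Multiset.toFinset_card_le _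
      _ ≤ (P n).natDegree := card_roots' _
      _ = n := h.natDegree_eq n

/-- A Dirichlet-type summation formula. -/
theorem sum_chebHalf_cos {α β : ℕ} (hα : α ≤ 1) (hβ : β ≤ 1) (r : ℕ) (θ : ℝ) :
    2 * sin (θ / 2) * (∑ j ∈ Finset.range (r + 1), chebHalf α β j * cos (chebFreq α β j * θ) +
      (α * β : ℕ) / 2) = sin ((chebFreq α β r + 1 / 2) * θ) := by
  have key : ∀ x : ℝ, 2 * sin (θ / 2) * cos (x * θ) =
      sin ((x + 1 / 2) * θ) - sin ((x - 1 / 2) * θ) := by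
    intro x
    rw [sin_sub_sin]
    ring_nf
  induction r with
  | zero =>
    have h0 := key ((α + β : ℕ) / 2)
    rw [Finset.sum_range_one]
    have h1 : chebFreq α β 0 = (α + β : ℕ) / 2 := by
      unfold chebFreq
      push_cast
      ring
    rw [h1, mul_add, mul_left_comm, h0]
    unfold chebHalf
    interval_cases α <;> interval_cases β <;> norm_num
    · ring
    · rw [show (1 / 2 : ℝ) * θ = θ / 2 by ring]
      ring
  | succ r ih =>
    have h1 : chebFreq α β (r + 1) = chebFreq α β r + 1 := by
      unfold chebFreq
      push_cast
      ring
    have h2 : chebHalf α β (r + 1) = 1 := by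
      unfold chebHalf
      rw [if_neg (by omega)]
    rw [Finset.sum_range_succ, add_right_comm, mul_add, ih, h2, one_mul, key, h1]
    ring_nf

end

theorem sum_vpFilter_mul {n m : ℕ} (hm : 0 < m) (hmn : m < n) (g : ℕ → ℝ) :
    ∑ j ∈ Finset.range (n + m), vpFilter n m j * g j =
      (∑ i ∈ Finset.range (2 * m), ∑ j ∈ Finset.range (n - m + i + 1), g j) / (2 * m) := by
  have h1 : ∀ i ∈ Finset.range (2 * m), ∑ j ∈ Finset.range (n - m + i + 1), g j =
      ∑ j ∈ Finset.range (n + m), if j < n - m + i + 1 then g j else 0 := by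
    intro i hi
    have hi := Finset.mem_range.1 hi
    rw [← Finset.sum_filter]
    congr 1
    ext j
    simp only [Finset.mem_range, Finset.mem_filter]
    omega
  have hm' : (m : ℝ) ≠ 0 := by positivity
  rw [Finset.sum_congr rfl h1, Finset.sum_comm, Finset.sum_div]
  refine Finset.sum_congr rfl fun j hj => ?_
  have hj := Finset.mem_range.1 hj
  have h2 : (Finset.range (2 * m)).filter (fun i => j < n - m + i + 1) =
      Finset.Ico (j - (n - m)) (2 * m) := by
    ext i
    simp only [Finset.mem_range, Finset.mem_filter, Finset.mem_Ico]
    omega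
  rw [← Finset.sum_filter, h2, Finset.sum_const, Nat.card_Ico, nsmul_eq_mul, vpFilter]
  split_ifs with h
  · rw [show 2 * m - (j - (n - m)) = 2 * m by omega]
    push_cast
    field_simp
  · have : ((2 * m - (j - (n - m)) : ℕ) : ℝ) = n + m - j := by
      rw [show 2 * m - (j - (n - m)) = n + m - j by omega, Nat.cast_sub hj.le]
      push_cast
      ring
    rw [this]
    ring

theorem sum_vpFilter_cos {α β n m : ℕ} (hα : α ≤ 1) (hβ : β ≤ 1) (hm : 0 < m) (hmn : m < n)
    {θ : ℝ} (hθ : sin (θ / 2) ≠ 0) :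
    ∑ j ∈ Finset.range (n + m), vpFilter n m j * (chebHalf α β j * cos (chebFreq α β j * θ)) =
      sin (chebFreq α β n * θ) * sin (m * θ) / (4 * m * sin (θ / 2) ^ 2) - (α * β : ℕ) / 2 := by
  have hm' : (m : ℝ) ≠ 0 := by positivity
  obtain ⟨e, he⟩ : ∃ e : ℝ, e = (α * β : ℕ) / 2 := ⟨_, rfl⟩
  rw [← he]
  have h1 : ∀ i : ℕ, 4 * sin (θ / 2) ^ 2 *
      (∑ j ∈ Finset.range (n - m + i + 1), chebHalf α β j * cos (chebFreq α β j * θ)) =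
      (cos ((chebFreq α β n - m + i) * θ) - cos ((chebFreq α β n - m + (i + 1 : ℕ)) * θ)) -
        4 * sin (θ / 2) ^ 2 * e := by
    intro i
    have h2 := sum_chebHalf_cos hα hβ (n - m + i) θ
    rw [← he] at h2
    have h3 : chebFreq α β (n - m + i) = chebFreq α β n - m + i := by
      unfold chebFreq
      push_cast [Nat.cast_sub hmn.le]
      ring
    rw [h3] at h2
    have h4 : cos ((chebFreq α β n - m + i) * θ) - cos ((chebFreq α β n - m + (i + 1 : ℕ)) * θ) =
        2 * sin (θ / 2) * sin ((chebFreq α β n - m + i + 1 / 2) * θ) := by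
      rw [cos_sub_cos,
        show ((chebFreq α β n - m + i) * θ - (chebFreq α β n - m + (i + 1 : ℕ)) * θ) / 2 =
          -(θ / 2) by push_cast; ring, sin_neg]
      push_cast
      rw [show ∀ a b : ℝ, -2 * a * -b = 2 * b * a by intros; ring]
      congr 2
      ring
    rw [h4]
    linear_combination 2 * sin (θ / 2) * h2
  have h5 : 4 * sin (θ / 2) ^ 2 * ∑ i ∈ Finset.range (2 * m),
      ∑ j ∈ Finset.range (n - m + i + 1), chebHalf α β j * cos (chebFreq α β j * θ) =
      2 * (sin (chebFreq α β n * θ) * sin (m * θ)) - 4 * sin (θ / 2) ^ 2 * e * (2 * m) := by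
    rw [Finset.mul_sum, Finset.sum_congr rfl fun i _ => h1 i, Finset.sum_sub_distrib,
      Finset.sum_range_sub' (fun i : ℕ => cos ((chebFreq α β n - m + i) * θ)), Finset.sum_const,
      Finset.card_range, nsmul_eq_mul]
    push_cast
    rw [cos_sub_cos]
    rw [show ((chebFreq α β n - m + 0) * θ + (chebFreq α β n - m + 2 * m) * θ) / 2 =
      chebFreq α β n * θ by ring, show ((chebFreq α β n - m + 0) * θ -
      (chebFreq α β n - m + 2 * m) * θ) / 2 = -(m * θ) by ring, sin_neg]
    ring
  rw [sum_vpFilter_mul hm hmn]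
  set S := ∑ i ∈ Finset.range (2 * m),
      ∑ j ∈ Finset.range (n - m + i + 1), chebHalf α β j * cos (chebFreq α β j * θ)
  field_simp
  linear_combination h5

/-- The bracket in the closed form of the fundamental polynomials. -/
noncomputable def vpBracket (m : ℕ) (t y : ℝ) : ℝ :=
  sin (m * (t - y)) / sin ((t - y) / 2) ^ 2 - sin (m * (t + y)) / sin ((t + y) / 2) ^ 2

theorem sin_freq_sub_node {α β n : ℕ} (hn : 0 < n) (k : ℕ) (t : ℝ) :
    sin (chebFreq α β n * (t - chebNode α β n k)) = -((-1) ^ k * chebTrig α β n t) := by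
  rw [mul_sub, chebFreq_mul_chebNode hn, chebTrig,
    show chebFreq α β n * t - (k + ((α : ℝ) + 1) / 2) * π =
      chebFreq α β n * t - α * (π / 2) - π / 2 - k * π by ring, sin_sub_nat_mul_pi,
    sin_sub_pi_div_two]
  ring

theorem sin_freq_add_node {α β n : ℕ} (hn : 0 < n) (k : ℕ) (t : ℝ) :
    sin (chebFreq α β n * (t + chebNode α β n k)) =
      (-1) ^ k * ((-1) ^ α * chebTrig α β n t) := by
  rw [mul_add, chebFreq_mul_chebNode hn, chebTrig,
    show chebFreq α β n * t + (k + ((α : ℝ) + 1) / 2) * π =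
      chebFreq α β n * t - α * (π / 2) + π / 2 + α * π + k * π by ring, sin_add_nat_mul_pi,
    sin_add_nat_mul_pi, sin_add_pi_div_two]

theorem sum_chebTrig_sq {α β n k : ℕ} (hα : α ≤ 1) (hβ : β ≤ 1) (hk : k < n) :
    ∑ j ∈ Finset.range n, chebHalf α β j * chebTrig α β j (chebNode α β n k) ^ 2 =
      chebFreq α β n / 2 := by
  obtain ⟨r, rfl⟩ : ∃ r, n = r + 1 := ⟨n - 1, by omega⟩
  set y := chebNode α β (r + 1) k with hy
  have hyN := chebFreq_mul_chebNode (α := α) (β := β) (by omega : 0 < r + 1) k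
  have hymem := chebNode_mem (α := α) (β := β) hk
  rw [← hy] at hyN hymem
  have h1 : ∀ j, chebHalf α β j * chebTrig α β j y ^ 2 = (1 / 2) * chebHalf α β j +
      ((-1) ^ α / 2) * (chebHalf α β j * cos (chebFreq α β j * (2 * y))) := by
    intro j
    rw [sq, chebTrig_mul_chebTrig, sub_self, cos_zero,
      show chebFreq α β j * y + chebFreq α β j * y = chebFreq α β j * (2 * y) by ring]
    ring
  have h2 := sum_chebHalf_cos hα hβ r (2 * y)
  have h3 : chebFreq α β (r + 1) = chebFreq α β r + 1 := by
    unfold chebFreq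
    push_cast
    ring
  rw [mul_div_cancel_left₀ _ two_ne_zero,
    show (chebFreq α β r + 1 / 2) * (2 * y) = 2 * (chebFreq α β (r + 1) * y) - y by
      rw [h3]; ring, hyN,
    show 2 * ((k + ((α : ℝ) + 1) / 2) * π) - y = π - y + α * π + k * (2 * π) by ring,
    sin_add_nat_mul_two_pi, sin_add_nat_mul_pi, sin_pi_sub] at h2
  have hs := sin_pos_of_pos_of_lt_pi hymem.1 hymem.2
  have h4 : ∑ j ∈ Finset.range (r + 1), chebHalf α β j * cos (chebFreq α β j * (2 * y)) =
      (-1) ^ α / 2 - (α * β : ℕ) / 2 := by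
    refine mul_left_cancel₀ (a := 2 * sin y) (by positivity) ?_
    linear_combination h2
  have h5 : ∑ j ∈ Finset.range (r + 1), chebHalf α β j =
      r + chebHalf α β 0 := by
    rw [Finset.sum_range_succ', Finset.sum_congr rfl (g := fun _ => (1 : ℝ))]
    · simp
    · intro j _
      unfold chebHalf
      rw [if_neg (by omega)]
  rw [Finset.sum_congr rfl fun j _ => h1 j, Finset.sum_add_distrib, ← Finset.mul_sum,
    ← Finset.mul_sum, h4, h5]
  unfold chebHalf chebFreq
  interval_cases α <;> interval_cases β <;> norm_num <;> ring

theorem sin_half_sub_ne_zero {t y : ℝ} (ht : t ∈ Ioo 0 π) (hy : y ∈ Ioo 0 π) (h : t ≠ y) :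
    sin ((t - y) / 2) ≠ 0 := by
  intro h0
  rw [sin_eq_zero_iff_of_lt_of_lt (by linarith [ht.1, hy.2, pi_pos])
    (by linarith [ht.2, hy.1, pi_pos])] at h0
  exact h (by linarith)

theorem sin_half_add_pos {t y : ℝ} (ht : t ∈ Ioo 0 π) (hy : y ∈ Ioo 0 π) :
    0 < sin ((t + y) / 2) :=
  sin_pos_of_pos_of_lt_pi (by linarith [ht.1, hy.1]) (by linarith [ht.2, hy.2])

section
variable {α β : ℕ} {w : ℝ → ℝ} {P : ℕ → ℝ[X]}

theorem IsChebSystem.christoffel_eq (h : IsChebSystem α β w P) {n k : ℕ} (hk : k < n) :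
    christoffel w n (cos (chebNode α β n k)) =
      chebRoot α β (chebNode α β n k) ^ 2 * π / chebFreq α β n := by
  have hN := chebFreq_pos (α := α) (β := β) (by omega : 0 < n)
  have hy := chebNode_mem (α := α) (β := β) hk
  have hr := chebRoot_pos α β hy
  have h1 : (∑ j ∈ Finset.range (n + 1),
      (orthoPoly w j).eval (cos (chebNode α β n k)) ^ 2) * chebRoot α β (chebNode α β n k) ^ 2 =
      chebFreq α β n / π := by
    have h2 : ∀ j, (orthoPoly w j).eval (cos (chebNode α β n k)) ^ 2 *
        chebRoot α β (chebNode α β n k) ^ 2 =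
        2 / π * (chebHalf α β j * chebTrig α β j (chebNode α β n k) ^ 2) := by
      intro j
      rw [h.orthoPoly_eq, ← mul_pow, h.eval_cos j _ hy, mul_pow, sq_sqrt, mul_assoc]
      have := chebHalf_pos α β j
      have := pi_pos
      positivity
    rw [Finset.sum_mul, Finset.sum_congr rfl fun j _ => h2 j, ← Finset.mul_sum,
      Finset.sum_range_succ, chebTrig_chebNode (by omega : 0 < n),
      sum_chebTrig_sq h.alpha_le h.beta_le hk]
    ring
  have hp := pi_pos
  unfold christoffel
  set S := ∑ j ∈ Finset.range (n + 1), (orthoPoly w j).eval (cos (chebNode α β n k)) ^ 2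
  have hS : S ≠ 0 := by
    intro h0
    rw [h0, zero_mul] at h1
    have : 0 < chebFreq α β n / π := by positivity
    linarith
  rw [eq_div_iff hp.ne'] at h1
  rw [eq_comm, div_eq_div_iff hN.ne' hS]
  linear_combination h1

theorem IsChebSystem.vpFundamental_mul (h : IsChebSystem α β w P) {n m k : ℕ} (hm : 0 < m)
    (hmn : m < n) (hk : k < n) {t : ℝ} (ht : t ∈ Ioo 0 π) (hne : t ≠ chebNode α β n k) :
    vpFundamental w n m (cos (chebNode α β n k)) (cos t) * chebRoot α β t =
      -((-1) ^ k * chebRoot α β (chebNode α β n k) *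
        (chebTrig α β n t * vpBracket m t (chebNode α β n k) / (4 * m * chebFreq α β n))) := by
  have hN := chebFreq_pos (α := α) (β := β) (by omega : 0 < n)
  have hy := chebNode_mem (α := α) (β := β) hk
  have hsub := sin_half_sub_ne_zero ht hy hne
  have hadd := (sin_half_add_pos ht hy).ne'
  have h1 := sin_freq_sub_node (α := α) (β := β) (by omega : 0 < n) k t
  have h2 := sin_freq_add_node (α := α) (β := β) (by omega : 0 < n) k t
  have hr := chebRoot_pos α β hy
  unfold vpFundamental
  rw [h.christoffel_eq hk]
  set y := chebNode α β n k
  have hp := pi_pos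
  have h3 : (∑ j ∈ Finset.range (n + m), vpFilter n m j * (orthoPoly w j).eval (cos t) *
      (orthoPoly w j).eval (cos y)) * (chebRoot α β t * chebRoot α β y) =
      (1 / π) * ((∑ j ∈ Finset.range (n + m),
          vpFilter n m j * (chebHalf α β j * cos (chebFreq α β j * (t - y)))) +
        (-1) ^ α * (∑ j ∈ Finset.range (n + m),
          vpFilter n m j * (chebHalf α β j * cos (chebFreq α β j * (t + y))))) := by
    rw [Finset.mul_sum, ← Finset.sum_add_distrib, Finset.sum_mul, Finset.mul_sum]
    refine Finset.sum_congr rfl fun j _ => ?_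
    have e1 := h.eval_cos j t ht
    have e2 := h.eval_cos j y hy
    have e3 := chebTrig_mul_chebTrig α β j j t y
    have e4 : √(2 / π * chebHalf α β j) * √(2 / π * chebHalf α β j) = 2 / π * chebHalf α β j := by
      have := chebHalf_pos α β j
      exact mul_self_sqrt (by positivity)
    rw [← mul_sub, ← mul_add] at e3
    rw [h.orthoPoly_eq,
      show vpFilter n m j * (P j).eval (cos t) * (P j).eval (cos y) *
        (chebRoot α β t * chebRoot α β y) = vpFilter n m j * (((P j).eval (cos t) *
        chebRoot α β t) * ((P j).eval (cos y) * chebRoot α β y)) by ring, e1, e2,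
      show ∀ a b c d : ℝ, a * b * (c * d) = (a * c) * (b * d) by intros; ring, e4, e3]
    field_simp
  rw [sum_vpFilter_cos h.alpha_le h.beta_le hm hmn hsub,
    sum_vpFilter_cos h.alpha_le h.beta_le hm hmn hadd, h1, h2] at h3
  have h5 : (((α * β : ℕ) : ℝ) / 2) * (1 + (-1) ^ α) = 0 := by
    have := h.alpha_le
    interval_cases α <;> simp
  have h6 : ((-1 : ℝ) ^ α) * (-1) ^ α = 1 := by
    rw [← mul_pow]
    simp
  have h7 : (-((-1) ^ k * chebTrig α β n t) * sin (m * (t - y)) /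
        (4 * m * sin ((t - y) / 2) ^ 2) - ((α * β : ℕ) : ℝ) / 2) +
      (-1) ^ α * ((-1) ^ k * ((-1) ^ α * chebTrig α β n t) * sin (m * (t + y)) /
        (4 * m * sin ((t + y) / 2) ^ 2) - ((α * β : ℕ) : ℝ) / 2) =
      -((-1) ^ k * chebTrig α β n t * vpBracket m t y / (4 * m)) := by
    unfold vpBracket
    linear_combination ((-1) ^ k * chebTrig α β n t * sin (m * (t + y)) /
        (4 * m * sin ((t + y) / 2) ^ 2)) * h6 - h5
  rw [h7] at h3
  refine mul_right_cancel₀ (b := chebRoot α β y) hr.ne' ?_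
  rw [show ∀ a b d e : ℝ, a * b * d * e = a * (b * (d * e)) by intros; ring, h3]
  field_simp

end

/-- The weight `sin (t / 2) ^ a * cos (t / 2) ^ b`. -/
noncomputable def trigWeight (a b t : ℝ) : ℝ := sin (t / 2) ^ a * cos (t / 2) ^ b

/-- The modulus of the unweighted kernel of the filtered interpolation. -/
noncomputable def vpKernel (α β n m : ℕ) (t y : ℝ) : ℝ :=
  |chebTrig α β n t * vpBracket m t y| / (4 * m * chebFreq α β n)

/-- The weighted Lebesgue function in the variable `t = arccos x`. -/
noncomputable def lebesgueFun (α β : ℕ) (a b : ℝ) (n m : ℕ) (t : ℝ) : ℝ :=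
  ∑ k ∈ Finset.range n, vpKernel α β n m t (chebNode α β n k) *
    (trigWeight a b t / trigWeight a b (chebNode α β n k))

theorem trigWeight_pos (a b : ℝ) {t : ℝ} (ht : t ∈ Ioo 0 π) : 0 < trigWeight a b t :=
  mul_pos (rpow_pos_of_pos (sin_half_pos ht) _) (rpow_pos_of_pos (cos_half_pos ht) _)

theorem vpKernel_nonneg (α β n m : ℕ) (t y : ℝ) : 0 ≤ vpKernel α β n m t y := by
  unfold vpKernel chebFreq
  positivity

theorem jacobiWeight_cos (α β : ℕ) (γ δ : ℝ) {t : ℝ} (ht : t ∈ Ioo 0 π) :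
    jacobiWeight γ δ (cos t) = (2 ^ γ * 2 ^ δ / (√2 ^ α * √2 ^ β)) *
      trigWeight (2 * γ - α) (2 * δ - β) t * chebRoot α β t := by
  have hs := sin_half_pos ht
  have hc := cos_half_pos ht
  have h2 : (0 : ℝ) < √2 := by positivity
  unfold jacobiWeight trigWeight chebRoot
  rw [one_sub_cos_eq, one_add_cos_eq, mul_rpow zero_le_two (sq_nonneg _),
    mul_rpow zero_le_two (sq_nonneg _), rpow_sub hs, rpow_sub hc, rpow_natCast, rpow_natCast,
    rpow_mul hs.le, rpow_mul hc.le, rpow_two, rpow_two, mul_pow, mul_pow]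
  field_simp

theorem jacobiWeight_pos (γ δ : ℝ) {x : ℝ} (hx : x ∈ Ioo (-1) 1) : 0 < jacobiWeight γ δ x :=
  mul_pos (rpow_pos_of_pos (by linarith [hx.2]) _) (rpow_pos_of_pos (by linarith [hx.1]) _)

theorem continuous_jacobiWeight {γ δ : ℝ} (hγ : 0 ≤ γ) (hδ : 0 ≤ δ) :
    Continuous (jacobiWeight γ δ) :=
  ((continuous_const.sub continuous_id).rpow_const fun _ => Or.inr hγ).mul
    ((continuous_const.add continuous_id).rpow_const fun _ => Or.inr hδ)

theorem continuous_vpInterp (w : ℝ → ℝ) (n m : ℕ) (f : ℝ → ℝ) :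
    Continuous (vpInterp w n m f) := by
  unfold vpInterp vpFundamental
  refine continuous_finsetSum _ fun z _ => continuous_const.mul (continuous_const.mul
    (continuous_finsetSum _ fun j _ => (continuous_const.mul ?_).mul continuous_const))
  exact (orthoPoly w j).continuous

theorem le_supNorm (g : ℝ → ℝ) {x : ℝ} (hx : x ∈ Icc (-1) 1) :
    ENNReal.ofReal |g x| ≤ supNorm g :=
  le_iSup₂ (f := fun x (_ : x ∈ Icc (-1 : ℝ) 1) => ENNReal.ofReal |g x|) x hx

theorem cos_mem_Ioo {t : ℝ} (ht : t ∈ Ioo 0 π) : cos t ∈ Ioo (-1) 1 :=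
  cos_image_Ioo ▸ mem_image_of_mem cos ht

section
variable {α β : ℕ} {w : ℝ → ℝ} {P : ℕ → ℝ[X]}

theorem IsChebSystem.vpInterp_cos (h : IsChebSystem α β w P) (n m : ℕ) (f : ℝ → ℝ) (x : ℝ) :
    vpInterp w n m f x = ∑ k ∈ Finset.range n, f (cos (chebNode α β n k)) *
      vpFundamental w n m (cos (chebNode α β n k)) x := by
  unfold vpInterp
  rw [h.nodes_eq, Finset.sum_image (injOn_cos_chebNode n)]

theorem IsChebSystem.abs_vpFundamental (h : IsChebSystem α β w P) {n m k : ℕ} (hm : 0 < m)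
    (hmn : m < n) (hk : k < n) {t : ℝ} (ht : t ∈ Ioo 0 π) (hne : t ≠ chebNode α β n k)
    (γ δ : ℝ) :
    |vpFundamental w n m (cos (chebNode α β n k)) (cos t)| * jacobiWeight γ δ (cos t) /
        jacobiWeight γ δ (cos (chebNode α β n k)) =
      vpKernel α β n m t (chebNode α β n k) * (trigWeight (2 * γ - α) (2 * δ - β) t /
        trigWeight (2 * γ - α) (2 * δ - β) (chebNode α β n k)) := by
  have hy := chebNode_mem (α := α) (β := β) hk
  have h1 := congrArg abs (h.vpFundamental_mul hm hmn hk ht hne)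
  rw [abs_mul, abs_of_pos (chebRoot_pos α β ht), abs_neg, abs_mul, abs_mul, abs_pow, abs_neg,
    abs_one, one_pow, one_mul, abs_of_pos (chebRoot_pos α β hy), abs_div,
    abs_of_pos (a := 4 * (m : ℝ) * _) (by
      have := chebFreq_pos (α := α) (β := β) (by omega : 0 < n)
      positivity)] at h1
  change _ = _ * vpKernel α β n m t _ at h1
  rw [jacobiWeight_cos α β γ δ ht, jacobiWeight_cos α β γ δ hy]
  have e1 := trigWeight_pos (2 * γ - α) (2 * δ - β) hy
  have e2 := chebRoot_pos α β hy
  have e3 : (0 : ℝ) < 2 ^ γ * 2 ^ δ / (√2 ^ α * √2 ^ β) := by positivity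
  rw [mul_div_assoc', div_eq_div_iff (by positivity) e1.ne']
  linear_combination (2 ^ γ * 2 ^ δ / (√2 ^ α * √2 ^ β)) *
    trigWeight (2 * γ - α) (2 * δ - β) t *
    trigWeight (2 * γ - α) (2 * δ - β) (chebNode α β n k) * h1

theorem dense_cos_not_node (α β n : ℕ) :
    Icc (-1 : ℝ) 1 ⊆ closure (cos '' {t ∈ Ioo 0 π | ∀ k < n, t ≠ chebNode α β n k}) := by
  set F : Set ℝ := (((Finset.range n).image fun k => cos (chebNode α β n k) : Finset ℝ) :
    Set ℝ) with hF
  have h1 : Ioo (-1 : ℝ) 1 ∩ Fᶜ ⊆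
      cos '' {t ∈ Ioo 0 π | ∀ k < n, t ≠ chebNode α β n k} := by
    rintro x ⟨hx, hxF⟩
    rw [← cos_image_Ioo] at hx
    obtain ⟨t, ht, rfl⟩ := hx
    refine ⟨t, ⟨ht, fun k hk hkt => hxF ?_⟩, rfl⟩
    rw [hF, Finset.mem_coe, Finset.mem_image]
    exact ⟨k, Finset.mem_range.2 hk, by rw [hkt]⟩
  have h2 : Dense Fᶜ := (Finset.finite_toSet _).countable.dense_compl ℝ
  rw [← closure_Ioo (by norm_num : (-1 : ℝ) ≠ 1)]
  refine (closure_minimal ?_ isClosed_closure).trans (closure_mono h1)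
  exact h2.open_subset_closure_inter isOpen_Ioo

theorem IsChebSystem.lebesgueConst_le (h : IsChebSystem α β w P) {n m : ℕ} (hm : 0 < m)
    (hmn : m < n) {γ δ : ℝ} (hγ : 0 ≤ γ) (hδ : 0 ≤ δ) {M : ℝ} (hM : 0 < M)
    (hb : ∀ t ∈ Ioo 0 π, (∀ k < n, t ≠ chebNode α β n k) →
      lebesgueFun α β (2 * γ - α) (2 * δ - β) n m t ≤ M) :
    lebesgueConst w (jacobiWeight γ δ) n m ≤ ENNReal.ofReal M := by
  refine iSup_le fun f => iSup_le fun _ => iSup_le fun _ => ?_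
  refine ENNReal.div_le_of_le_mul ?_
  set u := jacobiWeight γ δ
  by_cases htop : supNorm (fun x => f x * u x) = ⊤
  · rw [htop, ENNReal.mul_top (by simpa using hM)]
    exact le_top
  obtain ⟨F, hF⟩ : ∃ F, F = (supNorm fun x => f x * u x).toReal := ⟨_, rfl⟩
  have hF0 : 0 ≤ F := hF ▸ ENNReal.toReal_nonneg
  have hFle : ∀ x ∈ Icc (-1 : ℝ) 1, |f x * u x| ≤ F := by
    intro x hx
    rw [hF, ← ENNReal.ofReal_le_iff_le_toReal htop]
    exact le_supNorm (fun x => f x * u x) hx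
  have hcl : ∀ x ∈ Icc (-1 : ℝ) 1, |vpInterp w n m f x * u x| ≤ M * F := by
    have hclosed : IsClosed {x | |vpInterp w n m f x * u x| ≤ M * F} :=
      isClosed_le ((continuous_vpInterp w n m f).mul (continuous_jacobiWeight hγ hδ)).abs
        continuous_const
    refine (dense_cos_not_node α β n).trans (closure_minimal ?_ hclosed)
    rintro _ ⟨t, ⟨ht, hne⟩, rfl⟩
    have hut : 0 < u (cos t) := jacobiWeight_pos γ δ (cos_mem_Ioo ht)
    change |vpInterp w n m f (cos t) * u (cos t)| ≤ M * F
    rw [abs_mul, abs_of_pos hut, h.vpInterp_cos]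
    calc _ ≤ (∑ k ∈ Finset.range n, |f (cos (chebNode α β n k)) *
          vpFundamental w n m (cos (chebNode α β n k)) (cos t)|) * u (cos t) :=
        mul_le_mul_of_nonneg_right (Finset.abs_sum_le_sum_abs _ _) hut.le
      _ = ∑ k ∈ Finset.range n, |f (cos (chebNode α β n k)) * u (cos (chebNode α β n k))| *
          (|vpFundamental w n m (cos (chebNode α β n k)) (cos t)| * u (cos t) /
            u (cos (chebNode α β n k))) := by
        rw [Finset.sum_mul]
        refine Finset.sum_congr rfl fun k hk => ?_
        have huk : 0 < u (cos (chebNode α β n k)) :=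
          jacobiWeight_pos γ δ (cos_mem_Ioo (chebNode_mem (Finset.mem_range.1 hk)))
        rw [abs_mul, abs_mul, abs_of_pos huk]
        field_simp
      _ ≤ ∑ k ∈ Finset.range n, F *
          (vpKernel α β n m t (chebNode α β n k) * (trigWeight (2 * γ - α) (2 * δ - β) t /
        trigWeight (2 * γ - α) (2 * δ - β) (chebNode α β n k))) := by
        refine Finset.sum_le_sum fun k hk => ?_
        have hk := Finset.mem_range.1 hk
        have hy := chebNode_mem (α := α) (β := β) hk
        rw [h.abs_vpFundamental hm hmn hk ht (hne k hk)]
        refine mul_le_mul_of_nonneg_right (hFle _ (Ioo_subset_Icc_self (cos_mem_Ioo hy)))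
          (mul_nonneg (vpKernel_nonneg _ _ _ _ _ _) (div_pos (trigWeight_pos _ _ ht)
            (trigWeight_pos _ _ hy)).le)
      _ = lebesgueFun α β (2 * γ - α) (2 * δ - β) n m t * F := by
        rw [← Finset.mul_sum, mul_comm]
        rfl
      _ ≤ M * F := mul_le_mul_of_nonneg_right (hb t ht hne) hF0
  refine iSup₂_le fun x hx => ?_
  rw [← ENNReal.ofReal_toReal htop, ← hF, ← ENNReal.ofReal_mul hM.le]
  exact ENNReal.ofReal_le_ofReal (hcl x hx)

theorem IsChebSystem.le_lebesgueConst (h : IsChebSystem α β w P) {n m : ℕ} (hm : 0 < m)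
    (hmn : m < n) (γ δ : ℝ) {t : ℝ} (ht : t ∈ Ioo 0 π) (hne : ∀ k < n, t ≠ chebNode α β n k) :
    ENNReal.ofReal (lebesgueFun α β (2 * γ - α) (2 * δ - β) n m t) ≤
      lebesgueConst w (jacobiWeight γ δ) n m := by
  set u := jacobiWeight γ δ with hu
  set f : ℝ → ℝ := fun z => if z ∈ nodes w n then
    (if 0 ≤ vpFundamental w n m z (cos t) then 1 else -1) / u z else 0 with hf
  have hnodes : ∀ z ∈ nodes w n, z ∈ Ioo (-1 : ℝ) 1 := by
    intro z hz
    rw [h.nodes_eq] at hz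
    obtain ⟨k, hk, rfl⟩ := Finset.mem_image.1 hz
    exact cos_mem_Ioo (chebNode_mem (Finset.mem_range.1 hk))
  have hmem : ∀ k < n, cos (chebNode α β n k) ∈ nodes w n := by
    intro k hk
    rw [h.nodes_eq]
    exact Finset.mem_image_of_mem _ (Finset.mem_range.2 hk)
  have hlim : ∀ z ∉ Ioo (-1 : ℝ) 1, ∀ s : Set ℝ,
      Filter.Tendsto (fun x => f x * u x) (𝓝[s] z) (𝓝 0) := by
    intro z hz s
    refine tendsto_const_nhds.congr' ?_
    have : ∀ᶠ x in 𝓝 z, x ∉ nodes w n :=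
      (Finset.finite_toSet (nodes w n)).isClosed.isOpen_compl.mem_nhds
        fun hzn => hz (hnodes z hzn)
    filter_upwards [nhdsWithin_le_nhds this] with x hx
    simp only [hf, if_neg hx, zero_mul]
  have hadm : Admissible u f :=
    ⟨fun _ => hlim 1 (by simp) _, fun _ => hlim (-1) (by simp) _⟩
  have hnz : ∃ x ∈ Ioo (-1 : ℝ) 1, f x ≠ 0 := by
    have h0 := hmem 0 (by omega)
    refine ⟨_, hnodes _ h0, ?_⟩
    have := (jacobiWeight_pos γ δ (hnodes _ h0)).ne'
    simp only [hf, if_pos h0]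
    split_ifs <;> simpa [hu] using this
  have hnorm : supNorm (fun x => f x * u x) ≤ 1 := by
    refine iSup₂_le fun x hx => ?_
    rw [← ENNReal.ofReal_one]
    refine ENNReal.ofReal_le_ofReal ?_
    by_cases hxn : x ∈ nodes w n
    · have := (jacobiWeight_pos γ δ (hnodes _ hxn)).ne'
      simp only [hf, if_pos hxn]
      rw [div_mul_cancel₀ _ this]
      split_ifs <;> simp
    · simp [hf, if_neg hxn]
  have hut : 0 < u (cos t) := jacobiWeight_pos γ δ (cos_mem_Ioo ht)
  have hval : vpInterp w n m f (cos t) * u (cos t) =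
      lebesgueFun α β (2 * γ - α) (2 * δ - β) n m t := by
    rw [h.vpInterp_cos, Finset.sum_mul]
    refine Finset.sum_congr rfl fun k hk => ?_
    have hk := Finset.mem_range.1 hk
    rw [← h.abs_vpFundamental hm hmn hk ht (hne k hk)]
    simp only [hf, if_pos (hmem k hk)]
    split_ifs with hs
    · rw [abs_of_nonneg hs]
      ring
    · rw [abs_of_neg (not_le.1 hs)]
      ring
  have h1 : ENNReal.ofReal (lebesgueFun α β (2 * γ - α) (2 * δ - β) n m t) ≤
      supNorm (fun x => vpInterp w n m f x * u x) := by
    refine le_trans ?_ (le_supNorm (fun x => vpInterp w n m f x * u x)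
      (Ioo_subset_Icc_self (cos_mem_Ioo ht)))
    rw [hval]
    exact ENNReal.ofReal_le_ofReal (le_abs_self _)
  refine le_trans ?_ (le_iSup_of_le f (le_iSup₂_of_le hadm hnz le_rfl))
  calc _ ≤ supNorm (fun x => vpInterp w n m f x * u x) / 1 := by rwa [div_one]
    _ ≤ _ := ENNReal.div_le_div_left hnorm _

end

theorem abs_sin_nat_mul_le (k : ℕ) (x : ℝ) : |sin (k * x)| ≤ k * |sin x| := by
  induction k with
  | zero => simp
  | succ k ih =>
    push_cast
    rw [add_mul, one_mul, sin_add, add_mul, one_mul]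
    refine (abs_add_le _ _).trans (add_le_add ?_ ?_)
    · rw [abs_mul]
      exact (mul_le_of_le_one_right (abs_nonneg _) (abs_cos_le_one x)).trans ih
    · rw [abs_mul]
      exact mul_le_of_le_one_left (abs_nonneg _) (abs_cos_le_one _)

theorem rpow_div_le {X ξ r a : ℝ} (hX : 0 ≤ X) (hξ : 0 < ξ) (hr : 0 ≤ r) (h : X ≤ ξ + 2 * r)
    (ha : 0 ≤ a) (ha2 : a ≤ 2) : (X / ξ) ^ a ≤ 9 * (1 + (r / ξ) ^ a) := by
  have hu : 0 ≤ r / ξ := by positivity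
  have h1 : X / ξ ≤ 3 * max 1 (r / ξ) := by
    rw [div_le_iff₀ hξ]
    have e1 := mul_le_mul_of_nonneg_right (le_max_left 1 (r / ξ)) hξ.le
    have e2 := mul_le_mul_of_nonneg_right (le_max_right 1 (r / ξ)) hξ.le
    rw [div_mul_cancel₀ _ hξ.ne'] at e2
    linarith
  have h3 : (3 : ℝ) ^ a ≤ 9 :=
    (rpow_le_rpow_of_exponent_le (by norm_num) ha2).trans (by norm_num)
  have h4 : (max 1 (r / ξ)) ^ a ≤ 1 + (r / ξ) ^ a := by
    have := rpow_nonneg hu a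
    rcases max_cases 1 (r / ξ) with h | h <;> rw [h.1]
    · rw [one_rpow]
      linarith
    · linarith
  calc (X / ξ) ^ a ≤ (3 * max 1 (r / ξ)) ^ a := rpow_le_rpow (by positivity) h1 ha
    _ = 3 ^ a * (max 1 (r / ξ)) ^ a := mul_rpow (by norm_num) (by positivity)
    _ ≤ 9 * (1 + (r / ξ) ^ a) := mul_le_mul h3 h4 (by positivity) (by norm_num)

theorem one_add_rpow_div_le {x p : ℝ} (hx : 0 ≤ x) (hp : 0 ≤ p) :
    1 / (1 + x ^ 2) * (1 + x ^ p) ≤ 4 * (1 + x) ^ (p - 2) := by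
  have h1 : (1 : ℝ) ≤ (1 + x) ^ p := one_le_rpow (by linarith) hp
  have h2 : x ^ p ≤ (1 + x) ^ p := rpow_le_rpow hx (by linarith) hp
  rw [rpow_sub (by positivity), rpow_two]
  have h3 : 1 / (1 + x ^ 2) ≤ 2 / (1 + x) ^ 2 := by
    rw [div_le_div_iff₀ (by positivity) (by positivity)]
    nlinarith [sq_nonneg (x - 1)]
  calc _ ≤ 2 / (1 + x) ^ 2 * (2 * (1 + x) ^ p) :=
        mul_le_mul h3 (by linarith) (by positivity) (by positivity)
    _ = _ := by ring

theorem le_rpow_of_le {K D z p : ℝ} (hz : 0 ≤ z) (hD : 0 ≤ D) (hp : 0 ≤ p) (hp1 : p ≤ 1)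
    (h1 : K ≤ D) (h2 : K ≤ D * z) : K ≤ D * z ^ p := by
  rcases le_total z 1 with h | h
  · rcases hz.eq_or_lt with rfl | hz
    · rw [mul_zero] at h2
      exact h2.trans (by positivity)
    refine h2.trans (mul_le_mul_of_nonneg_left ?_ hD)
    calc z = z ^ (1 : ℝ) := (rpow_one z).symm
      _ ≤ z ^ p := rpow_le_rpow_of_exponent_ge hz h hp1
  · exact h1.trans (le_mul_of_one_le_right hD (one_le_rpow h hp))

theorem kernel_mul_rpow_le {N X Y ξ η r K C a p : ℝ} (hN : 0 < N) (hX : 0 < X) (hY : 0 < Y)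
    (hξ : 0 < ξ) (hη : 0 < η) (hr : 0 ≤ r) (hK : 0 ≤ K) (hC : 0 ≤ C) (hXξ : X ≤ ξ + 2 * r)
    (hηY : η ≤ Y + 2 * r) (hp : 0 ≤ p) (hp1 : p < 1) (ha : 0 ≤ a) (hap : a ≤ 2 - p)
    (h1 : K ≤ C * (1 / (1 + (N * r) ^ 2)))
    (h2 : K ≤ C * (1 / (1 + (N * r) ^ 2)) * (N * Y) ^ p) :
    K * ((X / ξ) ^ a * (η / Y) ^ p) ≤
      648 * C * ((1 + N * r) ^ (p - 2) + (N * ξ) ^ (p - 2)) := by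
  have e1 := rpow_div_le hX.le hξ hr hXξ ha (by linarith)
  have e2 := rpow_div_le hη.le hY hr hηY hp (by linarith)
  have e3 : (r / ξ) ^ a ≤ 1 + (r / ξ) ^ (2 - p) := by
    have hu : 0 ≤ r / ξ := by positivity
    rcases le_total (r / ξ) 1 with h | h
    · have := rpow_le_one hu h ha
      have := rpow_nonneg hu (2 - p)
      linarith
    · have := rpow_le_rpow_of_exponent_le h hap
      linarith
  set x := N * r with hx
  have hx0 : 0 ≤ x := by positivity
  have e4 : K * (1 + (r / Y) ^ p) ≤ C * (4 * (1 + x) ^ (p - 2)) := by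
    have : (N * Y) ^ p * (r / Y) ^ p = x ^ p := by
      rw [← mul_rpow (by positivity) (by positivity)]
      congr 1
      rw [hx]
      field_simp
    calc K * (1 + (r / Y) ^ p) = K + K * (r / Y) ^ p := by ring
      _ ≤ C * (1 / (1 + x ^ 2)) + C * (1 / (1 + x ^ 2)) * (N * Y) ^ p * (r / Y) ^ p :=
        add_le_add h1 (mul_le_mul_of_nonneg_right h2 (by positivity))
      _ = C * (1 / (1 + x ^ 2) * (1 + x ^ p)) := by rw [← this]; ring
      _ ≤ _ := mul_le_mul_of_nonneg_left (one_add_rpow_div_le hx0 hp) hC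
  have e5 : (1 + x) ^ (p - 2) * (r / ξ) ^ (2 - p) ≤ (N * ξ) ^ (p - 2) := by
    have h3 : r / ξ = x * (N * ξ)⁻¹ := by
      rw [hx]
      field_simp
    rw [h3, mul_rpow hx0 (by positivity), inv_rpow (by positivity), ← rpow_neg (by positivity),
      neg_sub, ← mul_assoc]
    refine mul_le_of_le_one_left (by positivity) ?_
    rw [← neg_sub, rpow_neg (by positivity), inv_mul_le_one₀ (by positivity)]
    exact rpow_le_rpow hx0 (by linarith) (by linarith)
  have h0 : (0 : ℝ) ≤ (r / ξ) ^ (2 - p) := by positivity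
  calc K * ((X / ξ) ^ a * (η / Y) ^ p)
      ≤ K * ((9 * (2 + (r / ξ) ^ (2 - p))) * (9 * (1 + (r / Y) ^ p))) := by
        refine mul_le_mul_of_nonneg_left (mul_le_mul ?_ e2 (by positivity) (by positivity)) hK
        linarith
    _ = 81 * (2 + (r / ξ) ^ (2 - p)) * (K * (1 + (r / Y) ^ p)) := by ring
    _ ≤ 81 * (2 + (r / ξ) ^ (2 - p)) * (C * (4 * (1 + x) ^ (p - 2))) :=
        mul_le_mul_of_nonneg_left e4 (by positivity)
    _ = 324 * C * (2 * (1 + x) ^ (p - 2) + (1 + x) ^ (p - 2) * (r / ξ) ^ (2 - p)) := by ring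
    _ ≤ 324 * C * (2 * (1 + x) ^ (p - 2) + 2 * (N * ξ) ^ (p - 2)) := by
        refine mul_le_mul_of_nonneg_left ?_ (by positivity)
        have : (0 : ℝ) ≤ (N * ξ) ^ (p - 2) := by positivity
        linarith
    _ = _ := by ring

theorem rpow_div_le_four {Y η b : ℝ} (hY : 0 < Y) (hY1 : Y ≤ 1) (hη : 1 / 2 ≤ η) (hb : 0 ≤ b)
    (hb2 : b ≤ 2) : (Y / η) ^ b ≤ 4 := by
  have hη0 : 0 < η := by linarith
  calc (Y / η) ^ b ≤ 2 ^ b := by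
        refine rpow_le_rpow (by positivity) ?_ hb
        rw [div_le_iff₀ hη0]
        linarith
    _ ≤ 2 ^ (2 : ℝ) := rpow_le_rpow_of_exponent_le (by norm_num) hb2
    _ = 4 := by norm_num

/-- The majorant of the weighted kernel. -/
noncomputable def kernelMajorant (N r ξ η q : ℝ) : ℝ :=
  (1 + N * r) ^ (q - 2) + (N * ξ) ^ (q - 2) + (N * η) ^ (q - 2)

theorem kernel_mul_weight_le {N X Y ξ η r K C a b : ℝ} (hN : 0 < N) (hX : 0 < X) (hY : 0 < Y)
    (hξ : 0 < ξ) (hη : 0 < η) (hr : 0 ≤ r) (hK : 0 ≤ K) (hC : 0 ≤ C)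
    (hXY : X ^ 2 + Y ^ 2 = 1) (hξη : ξ ^ 2 + η ^ 2 = 1)
    (hX1 : |X - ξ| ≤ 2 * r) (hY1 : |Y - η| ≤ 2 * r)
    (ha : -1 < a) (ha2 : a ≤ 2) (hb : -1 < b) (hb2 : b ≤ 2) (hab : |a - b| ≤ 2)
    (h1 : K ≤ C * (1 / (1 + (N * r) ^ 2)))
    (hKa : a < 0 → K ≤ C * (1 / (1 + (N * r) ^ 2)) * (N * X))
    (hKb : b < 0 → K ≤ C * (1 / (1 + (N * r) ^ 2)) * (N * Y)) :
    K * (X ^ a * Y ^ b / (ξ ^ a * η ^ b)) ≤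
      2592 * C * (kernelMajorant N r ξ η (max 0 (-a)) + kernelMajorant N r ξ η (max 0 (-b))) := by
  have hX1' := abs_le.1 hX1
  have hY1' := abs_le.1 hY1
  have hab' := abs_le.1 hab
  have hXle : X ≤ 1 := by nlinarith
  have hYle : Y ≤ 1 := by nlinarith
  have hξle : ξ ≤ 1 := by nlinarith
  have hηle : η ≤ 1 := by nlinarith
  have hhalf : ∀ {u v : ℝ}, 0 < u → 0 < v → u ^ 2 + v ^ 2 = 1 → 1 / 2 ≤ u ∨ 1 / 2 ≤ v := by
    intro u v hu hv huv
    by_contra! hcon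
    nlinarith [hcon.1, hcon.2]
  have hD : 0 ≤ C * (1 / (1 + (N * r) ^ 2)) := by positivity
  have e1 : 0 < (1 + N * r) := by positivity
  have hM : ∀ q, 0 ≤ kernelMajorant N r ξ η q := fun q => by
    unfold kernelMajorant
    positivity
  have hMξ : ∀ q, (1 + N * r) ^ (q - 2) + (N * ξ) ^ (q - 2) ≤ kernelMajorant N r ξ η q := by
    intro q
    have : 0 ≤ (N * η) ^ (q - 2) := by positivity
    unfold kernelMajorant
    linarith
  have hMη : ∀ q, (1 + N * r) ^ (q - 2) + (N * η) ^ (q - 2) ≤ kernelMajorant N r ξ η q := by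
    intro q
    have : 0 ≤ (N * ξ) ^ (q - 2) := by positivity
    unfold kernelMajorant
    linarith
  have hswapX : (X / ξ) ^ a = (ξ / X) ^ (-a) := by
    rw [rpow_neg (by positivity), ← inv_rpow (by positivity), inv_div]
  have hswapY : (Y / η) ^ b = (η / Y) ^ (-b) := by
    rw [rpow_neg (by positivity), ← inv_rpow (by positivity), inv_div]
  have hsplit : X ^ a * Y ^ b / (ξ ^ a * η ^ b) = (X / ξ) ^ a * (Y / η) ^ b := by
    rw [div_rpow hX.le hξ.le, div_rpow hY.le hη.le]
    field_simp
  have hfour : ∀ {A B G : ℝ}, 0 ≤ A → B ≤ 4 → K * A ≤ 648 * C * G → K * (A * B) ≤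
      2592 * C * G := by
    intro A B G hA hB hG
    calc K * (A * B) ≤ K * (A * 4) :=
          mul_le_mul_of_nonneg_left (mul_le_mul_of_nonneg_left hB hA) hK
      _ ≤ _ := by linarith
  have hone : ∀ {A G : ℝ}, 0 ≤ G → A ≤ 648 * C * G → A ≤ 2592 * C * G := by
    intro A G hG hA
    have : 0 ≤ C * G := by positivity
    linarith
  have hfin : ∀ {A G : ℝ}, A ≤ 2592 * C * G →
      G ≤ kernelMajorant N r ξ η (max 0 (-a)) + kernelMajorant N r ξ η (max 0 (-b)) →
      A ≤ 2592 * C * (kernelMajorant N r ξ η (max 0 (-a)) +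
        kernelMajorant N r ξ η (max 0 (-b))) := fun hA hG =>
    hA.trans (mul_le_mul_of_nonneg_left hG (by positivity))
  have hMa := hM (max 0 (-a))
  have hMb := hM (max 0 (-b))
  rw [hsplit]
  rcases le_or_gt 0 a with ha0 | ha0 <;> rcases le_or_gt 0 b with hb0 | hb0
  · rw [max_eq_left (by linarith : -a ≤ 0), max_eq_left (by linarith : -b ≤ 0)] at hfin ⊢
    have hM0 := hM 0
    rcases hhalf hξ hη hξη with h | h
    · have := kernel_mul_rpow_le hN hY hX hη hξ hr hK hC (by linarith) (by linarith) le_rfl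
        one_pos hb0 (by linarith) h1 (by simpa using h1)
      rw [rpow_zero, mul_one] at this
      rw [mul_comm ((X / ξ) ^ a)]
      exact hfin (hfour (by positivity) (rpow_div_le_four hX hXle h ha0 ha2) this)
        (by linarith [hMη 0])
    · have := kernel_mul_rpow_le hN hX hY hξ hη hr hK hC (by linarith) (by linarith) le_rfl
        one_pos ha0 (by linarith) h1 (by simpa using h1)
      rw [rpow_zero, mul_one] at this
      exact hfin (hfour (by positivity) (rpow_div_le_four hY hYle h hb0 hb2) this)
        (by linarith [hMξ 0])
  · rw [max_eq_right (by linarith : 0 ≤ -b)] at hfin hMb ⊢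
    have := kernel_mul_rpow_le hN hX hY hξ hη hr hK hC (by linarith) (by linarith)
      (by linarith : 0 ≤ -b) (by linarith) ha0 (by linarith) h1
      (le_rpow_of_le (by positivity) hD (by linarith) (by linarith) h1 (hKb hb0))
    rw [hswapY]
    exact hfin (hone (by positivity) this) (by linarith [hMξ (-b)])
  · rw [max_eq_right (by linarith : 0 ≤ -a)] at hfin hMa ⊢
    have := kernel_mul_rpow_le hN hY hX hη hξ hr hK hC (by linarith) (by linarith)
      (by linarith : 0 ≤ -a) (by linarith) hb0 (by linarith) h1
      (le_rpow_of_le (by positivity) hD (by linarith) (by linarith) h1 (hKa ha0))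
    rw [hswapX, mul_comm ((ξ / X) ^ (-a))]
    exact hfin (hone (by positivity) this) (by linarith [hMη (-a)])
  · rw [max_eq_right (by linarith : 0 ≤ -a), max_eq_right (by linarith : 0 ≤ -b)] at hfin ⊢
    rw [max_eq_right (by linarith : 0 ≤ -a)] at hMa
    rw [max_eq_right (by linarith : 0 ≤ -b)] at hMb
    rw [hswapX, hswapY]
    rcases hhalf hX hY hXY with h | h
    · have := kernel_mul_rpow_le hN hX hY hξ hη hr hK hC (by linarith) (by linarith)
        (by linarith : 0 ≤ -b) (by linarith) le_rfl (by linarith) h1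
        (le_rpow_of_le (by positivity) hD (by linarith) (by linarith) h1 (hKb hb0))
      rw [rpow_zero, one_mul] at this
      rw [mul_comm ((ξ / X) ^ (-a))]
      exact hfin (hfour (by positivity)
        (rpow_div_le_four hξ hξle h (by linarith) (by linarith)) this)
        (by linarith [hMξ (-b)])
    · have := kernel_mul_rpow_le hN hY hX hη hξ hr hK hC (by linarith) (by linarith)
        (by linarith : 0 ≤ -a) (by linarith) le_rfl (by linarith) h1
        (le_rpow_of_le (by positivity) hD (by linarith) (by linarith) h1 (hKa ha0))
      rw [rpow_zero, one_mul] at this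
      exact hfin (hfour (by positivity)
        (rpow_div_le_four hη hηle h (by linarith) (by linarith)) this)
        (by linarith [hMη (-a)])

theorem two_mul_chebFreq (α β n : ℕ) : 2 * chebFreq α β n = (2 * n + α + β : ℕ) := by
  unfold chebFreq
  push_cast
  ring

theorem chebFreq_comm (α β n : ℕ) : chebFreq β α n = chebFreq α β n := by
  unfold chebFreq
  ring

theorem abs_sin_chebFreq_mul_le (α β n : ℕ) (θ : ℝ) :
    |sin (chebFreq α β n * θ)| ≤ 2 * chebFreq α β n * |sin (θ / 2)| := by
  rw [two_mul_chebFreq]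
  refine le_trans (le_of_eq ?_) (abs_sin_nat_mul_le _ _)
  rw [← two_mul_chebFreq]
  ring_nf

theorem abs_chebTrig_le_one (α β n : ℕ) (t : ℝ) : |chebTrig α β n t| ≤ 1 := abs_cos_le_one _

theorem abs_chebTrig_pi_sub (α β n : ℕ) (t : ℝ) :
    |chebTrig α β n (π - t)| = |chebTrig β α n t| := by
  unfold chebTrig
  rw [← cos_neg, chebFreq_comm α β n,
    show -(chebFreq α β n * (π - t) - α * (π / 2)) =
      chebFreq α β n * t - β * (π / 2) - n * π by unfold chebFreq; ring,
    cos_sub_nat_mul_pi, abs_mul, abs_pow, abs_neg, abs_one, one_pow, one_mul]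

theorem abs_chebTrig_one (β n : ℕ) (t : ℝ) :
    |chebTrig 1 β n t| = |sin (chebFreq 1 β n * t)| := by
  rw [chebTrig, Nat.cast_one, one_mul, cos_sub_pi_div_two]

theorem abs_vpBracket_pi_sub (m : ℕ) (t y : ℝ) :
    |vpBracket m (π - t) (π - y)| = |vpBracket m t y| := by
  rw [← abs_neg]
  congr 1
  unfold vpBracket
  rw [show π - t - (π - y) = -(t - y) by ring, mul_neg, sin_neg, neg_div 2 (t - y), sin_neg,
    neg_sq, show (m : ℝ) * (π - t + (π - y)) = -(m * (t + y)) + m * (2 * π) by ring,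
    sin_add_nat_mul_two_pi, sin_neg, show (π - t + (π - y)) / 2 = π - (t + y) / 2 by ring,
    sin_pi_sub]
  ring

theorem vpKernel_pi_sub (α β n m : ℕ) (t y : ℝ) :
    vpKernel α β n m (π - t) (π - y) = vpKernel β α n m t y := by
  unfold vpKernel
  rw [abs_mul, abs_mul, abs_chebTrig_pi_sub, abs_vpBracket_pi_sub, chebFreq_comm α β]

theorem trigWeight_pi_sub (a b t : ℝ) : trigWeight a b (π - t) = trigWeight b a t := by
  unfold trigWeight
  rw [show (π - t) / 2 = π / 2 - t / 2 by ring, sin_pi_div_two_sub, cos_pi_div_two_sub, mul_comm]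

theorem lebesgueFun_pi_sub (α β : ℕ) (a b : ℝ) (n m : ℕ) (t : ℝ) :
    lebesgueFun α β a b n m (π - t) = lebesgueFun β α b a n m t := by
  unfold lebesgueFun
  rw [← Finset.sum_range_reflect]
  refine Finset.sum_congr rfl fun k hk => ?_
  have hk := Finset.mem_range.1 hk
  rw [← pi_sub_chebNode hk, vpKernel_pi_sub, trigWeight_pi_sub, trigWeight_pi_sub]

section
variable {α β n m k : ℕ} {t : ℝ}

theorem half_le_chebFreq_mul_sin (hk : k < n) :
    (k : ℝ) + 1 / 2 ≤ chebFreq α β n * sin (chebNode α β n k / 2) := by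
  have hN := chebFreq_pos (α := α) (β := β) (by omega : 0 < n)
  have hy := chebNode_mem (α := α) (β := β) hk
  have h1 := mul_le_sin (x := chebNode α β n k / 2) (by linarith [hy.1]) (by linarith [hy.2])
  have h2 := chebFreq_mul_chebNode (α := α) (β := β) (by omega : 0 < n) k
  calc (k : ℝ) + 1 / 2 ≤ k + ((α : ℝ) + 1) / 2 := by
        have : (0 : ℝ) ≤ α := by positivity
        linarith
    _ = chebFreq α β n * (2 / π * (chebNode α β n k / 2)) := by
        have := pi_pos
        field_simp
        linarith
    _ ≤ _ := mul_le_mul_of_nonneg_left h1 hN.le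

theorem half_le_chebFreq_mul_cos (hk : k < n) :
    ((n - 1 - k : ℕ) : ℝ) + 1 / 2 ≤ chebFreq α β n * cos (chebNode α β n k / 2) := by
  have h := half_le_chebFreq_mul_sin (α := β) (β := α) (by omega : n - 1 - k < n)
  rwa [← pi_sub_chebNode hk, chebFreq_comm α β,
    show (π - chebNode α β n k) / 2 = π / 2 - chebNode α β n k / 2 by ring,
    sin_pi_div_two_sub] at h

theorem abs_sin_half_sub_le_add {t y : ℝ} (ht : t ∈ Ioo 0 π) (hy : y ∈ Ioo 0 π) :
    |sin ((t - y) / 2)| ≤ sin ((t + y) / 2) := by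
  have h1 := sin_half_pos ht
  have h2 := sin_half_pos hy
  have h3 := cos_half_pos ht
  have h4 := cos_half_pos hy
  rw [sub_div, add_div, sin_sub, sin_add, abs_le]
  constructor <;> nlinarith [mul_pos h1 h4, mul_pos h3 h2]

theorem abs_sub_div_pi_le {t y : ℝ} (ht : t ∈ Ioo 0 π) (hy : y ∈ Ioo 0 π) :
    |t - y| / π ≤ |sin ((t - y) / 2)| := by
  have h := mul_abs_le_abs_sin (x := (t - y) / 2) (by
    rw [abs_le]
    constructor <;> linarith [ht.1, ht.2, hy.1, hy.2])
  rw [abs_div, abs_two] at h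
  refine le_trans (le_of_eq ?_) h
  ring

theorem abs_sin_half_sub_sin_half_le {t y : ℝ} (ht : t ∈ Ioo 0 π) (hy : y ∈ Ioo 0 π) :
    |sin (t / 2) - sin (y / 2)| ≤ 2 * |sin ((t - y) / 2)| := by
  have h1 := abs_sub_div_pi_le ht hy
  rw [div_le_iff₀ pi_pos] at h1
  have h2 : |sin (t / 2) - sin (y / 2)| ≤ |t - y| / 2 := by
    rw [sin_sub_sin, abs_mul, abs_mul, abs_two]
    have e1 := abs_cos_le_one ((t / 2 + y / 2) / 2)
    have e2 := abs_sin_le_abs (x := (t / 2 - y / 2) / 2)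
    have e3 : |(t / 2 - y / 2) / 2| = |t - y| / 4 := by
      rw [show (t / 2 - y / 2) / 2 = (t - y) / 4 by ring, abs_div, abs_of_pos (four_pos (α := ℝ))]
    rw [e3] at e2
    calc _ ≤ 2 * (|t - y| / 4) * 1 := by
          refine mul_le_mul (by linarith) e1 (abs_nonneg _) (by positivity)
      _ = _ := by ring
  have h3 := pi_lt_four
  nlinarith [abs_nonneg (sin ((t - y) / 2))]

theorem abs_cos_half_sub_cos_half_le {t y : ℝ} (ht : t ∈ Ioo 0 π) (hy : y ∈ Ioo 0 π) :
    |cos (t / 2) - cos (y / 2)| ≤ 2 * |sin ((t - y) / 2)| := by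
  have h := abs_sin_half_sub_sin_half_le (t := π - t) (y := π - y)
    ⟨by linarith [ht.2], by linarith [ht.1]⟩ ⟨by linarith [hy.2], by linarith [hy.1]⟩
  rwa [show (π - t) / 2 = π / 2 - t / 2 by ring, show (π - y) / 2 = π / 2 - y / 2 by ring,
    sin_pi_div_two_sub, sin_pi_div_two_sub, show (π - t - (π - y)) / 2 = -((t - y) / 2) by ring,
    sin_neg, abs_neg] at h

theorem vpKernel_le_two (hm : 0 < m) (hk : k < n) (ht : t ∈ Ioo 0 π)
    (hne : t ≠ chebNode α β n k) : vpKernel α β n m t (chebNode α β n k) ≤ 2 := by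
  have hN := chebFreq_pos (α := α) (β := β) (by omega : 0 < n)
  have hy := chebNode_mem (α := α) (β := β) hk
  have h1 := congrArg abs (sin_freq_sub_node (α := α) (β := β) (by omega : 0 < n) k t)
  have h2 := congrArg abs (sin_freq_add_node (α := α) (β := β) (by omega : 0 < n) k t)
  rw [abs_neg, abs_mul, abs_pow, abs_neg, abs_one, one_pow, one_mul] at h1
  rw [abs_mul, abs_pow, abs_neg, abs_one, one_pow, one_mul, abs_mul, abs_pow, abs_neg, abs_one,
    one_pow, one_mul] at h2
  have hsub := sin_half_sub_ne_zero ht hy hne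
  have hadd := sin_half_add_pos ht hy
  set y := chebNode α β n k
  have hterm : ∀ θ : ℝ, sin (θ / 2) ≠ 0 → |sin (chebFreq α β n * θ)| = |chebTrig α β n t| →
      |chebTrig α β n t * (sin (m * θ) / sin (θ / 2) ^ 2)| ≤ 4 * m * chebFreq α β n := by
    intro θ hθ he
    have e1 := abs_sin_chebFreq_mul_le α β n θ
    have e2 : |sin (m * θ)| ≤ 2 * m * |sin (θ / 2)| := by
      refine le_trans (le_of_eq ?_) ((abs_sin_nat_mul_le (2 * m) (θ / 2)).trans (le_of_eq ?_))
      · push_cast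
        ring_nf
      · push_cast
        ring
    rw [abs_mul, ← he, abs_div, abs_pow, mul_div_assoc', div_le_iff₀ (by positivity)]
    calc _ ≤ (2 * chebFreq α β n * |sin (θ / 2)|) * (2 * m * |sin (θ / 2)|) :=
          mul_le_mul e1 e2 (abs_nonneg _) (by positivity)
      _ = _ := by ring
  unfold vpKernel vpBracket
  rw [div_le_iff₀ (by positivity), mul_sub]
  refine (abs_sub _ _).trans ?_
  linarith [hterm _ hsub h1, hterm _ hadd.ne' h2]

theorem vpKernel_le_div (hm : 0 < m) (hk : k < n) (ht : t ∈ Ioo 0 π)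
    (hne : t ≠ chebNode α β n k) {A : ℝ} (hA : chebFreq α β n ≤ A * m) :
    vpKernel α β n m t (chebNode α β n k) ≤ |chebTrig α β n t| *
      (A / (chebFreq α β n * |sin ((t - chebNode α β n k) / 2)|) ^ 2) := by
  have hN := chebFreq_pos (α := α) (β := β) (by omega : 0 < n)
  have hy := chebNode_mem (α := α) (β := β) hk
  have hsub := abs_pos.2 (sin_half_sub_ne_zero ht hy hne)
  have hle := abs_sin_half_sub_le_add ht hy
  set y := chebNode α β n k
  have hm' : (0 : ℝ) < m := by positivity
  have hB : |vpBracket m t y| ≤ 2 / |sin ((t - y) / 2)| ^ 2 := by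
    unfold vpBracket
    refine (abs_sub _ _).trans ?_
    rw [abs_div, abs_div, abs_pow, abs_pow, abs_of_pos (sin_half_add_pos ht hy)]
    have e1 : |sin (m * (t - y))| / |sin ((t - y) / 2)| ^ 2 ≤ 1 / |sin ((t - y) / 2)| ^ 2 :=
      div_le_div_of_nonneg_right (abs_sin_le_one _) (by positivity)
    have e2 : |sin (m * (t + y))| / sin ((t + y) / 2) ^ 2 ≤ 1 / |sin ((t - y) / 2)| ^ 2 :=
      div_le_div₀ zero_le_one (abs_sin_le_one _) (by positivity)
        (pow_le_pow_left₀ hsub.le hle 2)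
    exact (add_le_add e1 e2).trans (le_of_eq (by ring))
  unfold vpKernel
  rw [abs_mul, mul_div_assoc]
  refine mul_le_mul_of_nonneg_left ?_ (abs_nonneg _)
  calc |vpBracket m t y| / (4 * m * chebFreq α β n)
      ≤ 2 / |sin ((t - y) / 2)| ^ 2 / (4 * m * chebFreq α β n) :=
        div_le_div_of_nonneg_right hB (by positivity)
    _ ≤ A / (chebFreq α β n * |sin ((t - y) / 2)|) ^ 2 := by
        rw [div_div, mul_pow, div_le_div_iff₀ (by positivity) (by positivity)]
        have : 0 ≤ chebFreq α β n * |sin ((t - y) / 2)| ^ 2 := by positivity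
        nlinarith [mul_le_mul_of_nonneg_left hA this]

theorem vpKernel_le_inv (hm : 0 < m) (hk : k < n) (ht : t ∈ Ioo 0 π)
    (hne : t ≠ chebNode α β n k) {A : ℝ} (hA : chebFreq α β n ≤ A * m) :
    vpKernel α β n m t (chebNode α β n k) ≤ (4 + 2 * A) *
      (1 / (1 + (chebFreq α β n * |sin ((t - chebNode α β n k) / 2)|) ^ 2)) := by
  have hN := chebFreq_pos (α := α) (β := β) (by omega : 0 < n)
  have hA0 : 0 < A := pos_of_mul_pos_left (hN.trans_le hA) (by positivity)
  have hsub := abs_pos.2 (sin_half_sub_ne_zero ht (chebNode_mem hk) hne)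
  have h1 := vpKernel_le_two hm hk ht hne
  have h2 := vpKernel_le_div hm hk ht hne hA
  have h3 := abs_chebTrig_le_one α β n t
  set x := chebFreq α β n * |sin ((t - chebNode α β n k) / 2)|
  have hx : 0 < x := by positivity
  rcases le_total x 1 with h | h
  · refine h1.trans ?_
    rw [mul_one_div, le_div_iff₀ (by positivity)]
    nlinarith
  · have h4 : A / x ^ 2 ≤ (4 + 2 * A) * (1 / (1 + x ^ 2)) := by
      rw [mul_one_div, div_le_div_iff₀ (by positivity) (by positivity)]
      nlinarith [mul_le_mul h h zero_le_one hx.le]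
    exact (h2.trans (mul_le_of_le_one_left (by positivity) h3)).trans h4

theorem vpKernel_le_mul_sin (hm : 0 < m) (hk : k < n) (ht : t ∈ Ioo 0 π)
    (hne : t ≠ chebNode 1 β n k) {A : ℝ} (hA : chebFreq 1 β n ≤ A * m) :
    vpKernel 1 β n m t (chebNode 1 β n k) ≤ (65 * (4 + 2 * A)) *
      (1 / (1 + (chebFreq 1 β n * |sin ((t - chebNode 1 β n k) / 2)|) ^ 2)) *
      (chebFreq 1 β n * sin (t / 2)) := by
  have hN := chebFreq_pos (α := 1) (β := β) (by omega : 0 < n)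
  have hA0 : 0 < A := pos_of_mul_pos_left (hN.trans_le hA) (by positivity)
  have hy := chebNode_mem (α := 1) (β := β) hk
  have hsub := abs_pos.2 (sin_half_sub_ne_zero ht hy hne)
  have h1 := vpKernel_le_inv hm hk ht hne hA
  have h2 := vpKernel_le_div hm hk ht hne hA
  have h3 := abs_sin_chebFreq_mul_le 1 β n t
  have hs := sin_half_pos ht
  rw [← abs_chebTrig_one, abs_of_pos hs] at h3
  have h4 := half_le_chebFreq_mul_sin (α := 1) (β := β) hk
  have h5 := (abs_le.1 (abs_sin_half_sub_sin_half_le ht hy)).1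
  have h6 := mul_le_mul_of_nonneg_left h5 hN.le
  have hk0 : (0 : ℝ) ≤ k := by positivity
  set x := chebFreq 1 β n * |sin ((t - chebNode 1 β n k) / 2)| with hx'
  set z := chebFreq 1 β n * sin (t / 2) with hz'
  have hz : 0 < z := by positivity
  have hx : 0 < x := by positivity
  rcases le_total (1 / 4) z with h | h
  · refine h1.trans ?_
    have : 0 ≤ (4 + 2 * A) * (1 / (1 + x ^ 2)) := by positivity
    nlinarith
  · have h7 : 1 / 8 ≤ x := by nlinarith
    have h8 : A / x ^ 2 * 2 ≤ 65 * (4 + 2 * A) * (1 / (1 + x ^ 2)) := by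
      rw [mul_one_div, div_mul_eq_mul_div, div_le_div_iff₀ (by positivity) (by positivity)]
      have : 1 + x ^ 2 ≤ 65 * x ^ 2 := by nlinarith
      nlinarith [mul_le_mul_of_nonneg_left this hA0.le, sq_nonneg x]
    calc _ ≤ _ := h2
      _ ≤ (2 * z) * (A / x ^ 2) := mul_le_mul_of_nonneg_right (by linarith) (by positivity)
      _ = (A / x ^ 2 * 2) * z := by ring
      _ ≤ _ := mul_le_mul_of_nonneg_right h8 hz.le

theorem vpKernel_le_mul_cos (hm : 0 < m) (hk : k < n) (ht : t ∈ Ioo 0 π)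
    (hne : t ≠ chebNode α 1 n k) {A : ℝ} (hA : chebFreq α 1 n ≤ A * m) :
    vpKernel α 1 n m t (chebNode α 1 n k) ≤ (65 * (4 + 2 * A)) *
      (1 / (1 + (chebFreq α 1 n * |sin ((t - chebNode α 1 n k) / 2)|) ^ 2)) *
      (chebFreq α 1 n * cos (t / 2)) := by
  have hpi := pi_sub_chebNode (α := α) (β := 1) hk
  have h := vpKernel_le_mul_sin (n := n) (β := α) (k := n - 1 - k) (t := π - t) hm (by omega)
    ⟨by linarith [ht.2], by linarith [ht.1]⟩ (by
      rw [← hpi]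
      exact fun h => hne (by linarith)) (A := A) (by rwa [chebFreq_comm])
  rwa [← hpi, vpKernel_pi_sub, chebFreq_comm α 1, show (π - t) / 2 = π / 2 - t / 2 by ring,
    sin_pi_div_two_sub, show (π - t - (π - chebNode α 1 n k)) / 2 =
      -((t - chebNode α 1 n k) / 2) by ring, sin_neg, abs_neg] at h

end

theorem summable_one_add_abs_rpow {q : ℝ} (hq : q < 1) :
    Summable fun i : ℤ => (1 + |(i : ℝ)|) ^ (q - 2) := by
  have h : Summable fun i : ℕ => (1 + (i : ℝ)) ^ (q - 2) := by
    have := (summable_nat_add_iff 1).2 (Real.summable_nat_rpow (p := q - 2).2 (by linarith))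
    refine this.congr fun i => ?_
    push_cast
    rw [add_comm]
  refine Summable.of_nat_of_neg ?_ ?_
  · refine h.congr fun i => ?_
    simp
  · refine h.congr fun i => ?_
    simp

theorem sum_one_add_abs_rpow_le {q : ℝ} (hq : q < 1) (j : ℤ) (n : ℕ) :
    ∑ k ∈ Finset.range n, (1 + |(((k : ℤ) - j : ℤ) : ℝ)|) ^ (q - 2) ≤
      ∑' i : ℤ, (1 + |(i : ℝ)|) ^ (q - 2) := by
  have hinj : Set.InjOn (fun k : ℕ => (k : ℤ) - j) (Finset.range n) := by
    intro a _ b _ h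
    simp only at h
    omega
  rw [← Finset.sum_image (f := fun i : ℤ => (1 + |(i : ℝ)|) ^ (q - 2)) hinj]
  exact (summable_one_add_abs_rpow hq).sum_le_tsum _ fun i _ => by positivity

theorem rpow_le_four_mul_rpow {q x y : ℝ} (hq0 : 0 ≤ q) (hq : q < 1) (hy : 0 < y)
    (h : y ≤ 2 * x) : x ^ (q - 2) ≤ 4 * y ^ (q - 2) := by
  have hx : 0 < x := by linarith
  have h1 : x ^ (q - 2) ≤ (y / 2) ^ (q - 2) :=
    rpow_le_rpow_of_nonpos (by positivity) (by linarith) (by linarith)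
  refine h1.trans ?_
  rw [div_rpow hy.le zero_le_two, div_eq_mul_inv, mul_comm, ← rpow_neg zero_le_two]
  refine mul_le_mul_of_nonneg_right ?_ (by positivity)
  calc (2 : ℝ) ^ (-(q - 2)) ≤ 2 ^ (2 : ℝ) :=
        rpow_le_rpow_of_exponent_le (by norm_num) (by linarith)
    _ = 4 := by norm_num

theorem sum_kernelMajorant_le {α β n : ℕ} {q t : ℝ} (hq0 : 0 ≤ q) (hq : q < 1)
    (ht : t ∈ Ioo 0 π) :
    ∑ k ∈ Finset.range n, kernelMajorant (chebFreq α β n) |sin ((t - chebNode α β n k) / 2)|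
      (sin (chebNode α β n k / 2)) (cos (chebNode α β n k / 2)) q ≤
      12 * ∑' i : ℤ, (1 + |(i : ℝ)|) ^ (q - 2) := by
  set Z := ∑' i : ℤ, (1 + |(i : ℝ)|) ^ (q - 2)
  have h0 := sum_one_add_abs_rpow_le hq 0 n
  set j : ℤ := ⌊chebFreq α β n * t / π - ((α : ℝ) + 1) / 2⌋ with hj
  have h1 := sum_one_add_abs_rpow_le hq j n
  have s1 : ∑ k ∈ Finset.range n,
      (chebFreq α β n * sin (chebNode α β n k / 2)) ^ (q - 2) ≤ 4 * Z := by
    refine le_trans ?_ (mul_le_mul_of_nonneg_left h0 zero_le_four)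
    rw [Finset.mul_sum]
    refine Finset.sum_le_sum fun k hk => rpow_le_four_mul_rpow hq0 hq (by positivity) ?_
    have := half_le_chebFreq_mul_sin (α := α) (β := β) (Finset.mem_range.1 hk)
    simp only [sub_zero, Int.cast_natCast, Nat.abs_cast]
    linarith
  have s2 : ∑ k ∈ Finset.range n,
      (chebFreq α β n * cos (chebNode α β n k / 2)) ^ (q - 2) ≤ 4 * Z := by
    refine le_trans ?_ (mul_le_mul_of_nonneg_left h0 zero_le_four)
    rw [Finset.mul_sum, ← Finset.sum_range_reflect (fun k : ℕ =>
      4 * (1 + |(((k : ℤ) - 0 : ℤ) : ℝ)|) ^ (q - 2))]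
    refine Finset.sum_le_sum fun k hk => rpow_le_four_mul_rpow hq0 hq (by positivity) ?_
    have := half_le_chebFreq_mul_cos (α := α) (β := β) (Finset.mem_range.1 hk)
    simp only [sub_zero, Int.cast_natCast, Nat.abs_cast]
    linarith
  have s3 : ∑ k ∈ Finset.range n,
      (1 + chebFreq α β n * |sin ((t - chebNode α β n k) / 2)|) ^ (q - 2) ≤ 4 * Z := by
    refine le_trans ?_ (mul_le_mul_of_nonneg_left h1 zero_le_four)
    rw [Finset.mul_sum]
    refine Finset.sum_le_sum fun k hk => rpow_le_four_mul_rpow hq0 hq (by positivity) ?_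
    have hk := Finset.mem_range.1 hk
    have hN := chebFreq_pos (α := α) (β := β) (by omega : 0 < n)
    have e1 := mul_le_mul_of_nonneg_left
      (abs_sub_div_pi_le ht (chebNode_mem (α := α) (β := β) hk)) hN.le
    have e2 : chebFreq α β n * (|t - chebNode α β n k| / π) =
        |chebFreq α β n * t / π - ((α : ℝ) + 1) / 2 - k| := by
      have e3 : chebFreq α β n * t / π - ((α : ℝ) + 1) / 2 - k =
          chebFreq α β n * ((t - chebNode α β n k) / π) := by
        have := chebFreq_mul_chebNode (α := α) (β := β) (by omega : 0 < n) k
        have hp := pi_pos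
        rw [sub_div, mul_sub, mul_div_assoc', mul_div_assoc', this]
        field_simp
        ring
      rw [e3, abs_mul, abs_of_pos hN, abs_div, abs_of_pos pi_pos]
    rw [e2] at e1
    have f1 := Int.floor_le (chebFreq α β n * t / π - ((α : ℝ) + 1) / 2)
    have f2 := Int.lt_floor_add_one (chebFreq α β n * t / π - ((α : ℝ) + 1) / 2)
    rw [← hj] at f1 f2
    push_cast
    have f3 : |(k : ℝ) - j| ≤ 1 + |chebFreq α β n * t / π - ((α : ℝ) + 1) / 2 - k| := by
      set Y := chebFreq α β n * t / π - ((α : ℝ) + 1) / 2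
      rw [abs_le]
      have := le_abs_self (Y - k)
      have := neg_abs_le (Y - k)
      constructor <;> linarith
    have := abs_nonneg (chebFreq α β n * t / π - ((α : ℝ) + 1) / 2 - k)
    linarith
  unfold kernelMajorant
  rw [Finset.sum_add_distrib, Finset.sum_add_distrib]
  linarith

theorem exists_lebesgueFun_le {α β : ℕ} {a b A : ℝ} (hA : 0 < A)
    (ha : -1 < a) (ha2 : a ≤ 2) (hb : -1 < b) (hb2 : b ≤ 2) (hab : |a - b| ≤ 2)
    (haα : a < 0 → α = 1) (hbβ : b < 0 → β = 1) :
    ∃ M, 0 < M ∧ ∀ n m : ℕ, 0 < m → m < n → chebFreq α β n ≤ A * m →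
      ∀ t ∈ Ioo 0 π, (∀ k < n, t ≠ chebNode α β n k) → lebesgueFun α β a b n m t ≤ M := by
  set q1 := max 0 (-a)
  set q2 := max 0 (-b)
  have hq1 : q1 < 1 := max_lt one_pos (by linarith)
  have hq2 : q2 < 1 := max_lt one_pos (by linarith)
  set Z1 := ∑' i : ℤ, (1 + |(i : ℝ)|) ^ (q1 - 2)
  set Z2 := ∑' i : ℤ, (1 + |(i : ℝ)|) ^ (q2 - 2)
  have hZ1 : 0 ≤ Z1 := tsum_nonneg fun i => by positivity
  have hZ2 : 0 ≤ Z2 := tsum_nonneg fun i => by positivity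
  set C := 65 * (4 + 2 * A) with hC
  have hC0 : 0 < C := by positivity
  refine ⟨2592 * C * (12 * Z1 + 12 * Z2) + 1, by positivity, fun n m hm hmn hAm t ht hne => ?_⟩
  have hN := chebFreq_pos (α := α) (β := β) (by omega : 0 < n)
  have hterm : ∀ k ∈ Finset.range n, vpKernel α β n m t (chebNode α β n k) *
      (trigWeight a b t / trigWeight a b (chebNode α β n k)) ≤ 2592 * C *
      (kernelMajorant (chebFreq α β n) |sin ((t - chebNode α β n k) / 2)|
        (sin (chebNode α β n k / 2)) (cos (chebNode α β n k / 2)) q1 +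
      kernelMajorant (chebFreq α β n) |sin ((t - chebNode α β n k) / 2)|
        (sin (chebNode α β n k / 2)) (cos (chebNode α β n k / 2)) q2) := by
    intro k hk
    have hk := Finset.mem_range.1 hk
    have hy := chebNode_mem (α := α) (β := β) hk
    refine kernel_mul_weight_le hN (sin_half_pos ht) (cos_half_pos ht) (sin_half_pos hy)
      (cos_half_pos hy) (abs_nonneg _) (vpKernel_nonneg _ _ _ _ _ _) hC0.le (sin_sq_add_cos_sq _)
      (sin_sq_add_cos_sq _) (abs_sin_half_sub_sin_half_le ht hy)
      (abs_cos_half_sub_cos_half_le ht hy) ha ha2 hb hb2 hab ?_ ?_ ?_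
    · refine (vpKernel_le_inv hm hk ht (hne k hk) hAm).trans
        (mul_le_mul_of_nonneg_right ?_ (by positivity))
      rw [hC]
      linarith
    · intro h
      obtain rfl := haα h
      exact vpKernel_le_mul_sin hm hk ht (hne k hk) hAm
    · intro h
      obtain rfl := hbβ h
      exact vpKernel_le_mul_cos hm hk ht (hne k hk) hAm
  unfold lebesgueFun
  refine (Finset.sum_le_sum hterm).trans ?_
  rw [← Finset.mul_sum, Finset.sum_add_distrib]
  have s1 := sum_kernelMajorant_le (α := α) (β := β) (n := n) (le_max_left 0 (-a)) hq1 ht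
  have s2 := sum_kernelMajorant_le (α := α) (β := β) (n := n) (le_max_left 0 (-b)) hq2 ht
  have := mul_le_mul_of_nonneg_left (add_le_add s1 s2) (by positivity : 0 ≤ 2592 * C)
  linarith

theorem IsChebSystem.supLebesgueConst_lt_top {α β : ℕ} {w : ℝ → ℝ} {P : ℕ → ℝ[X]}
    (h : IsChebSystem α β w P) {γ δ c : ℝ} (hγ : 0 ≤ γ) (hδ : 0 ≤ δ) (hc : 1 < c)
    (ha : -1 < 2 * γ - α) (ha2 : 2 * γ - α ≤ 2) (hb : -1 < 2 * δ - β) (hb2 : 2 * δ - β ≤ 2)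
    (hab : |2 * γ - α - (2 * δ - β)| ≤ 2) :
    supLebesgueConst w (jacobiWeight γ δ) c < ⊤ := by
  have hα := h.alpha_le
  have hβ := h.beta_le
  obtain ⟨M, hM, hbound⟩ := exists_lebesgueFun_le (α := α) (β := β) (A := c + 1) (by linarith)
    ha ha2 hb hb2 hab
    (fun h0 => by
      by_contra h1
      obtain rfl : α = 0 := by omega
      push_cast at h0
      linarith)
    (fun h0 => by
      by_contra h1
      obtain rfl : β = 0 := by omega
      push_cast at h0
      linarith)
  refine lt_of_le_of_lt ?_ (ENNReal.ofReal_lt_top (r := M))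
  refine iSup_le fun n => iSup_le fun m => iSup_le fun hmn => iSup_le fun hcm => ?_
  have hm : 0 < m := by
    rcases Nat.eq_zero_or_pos m with rfl | h0
    · simp at hcm
      omega
    · exact h0
  refine h.lebesgueConst_le hm hmn hγ hδ hM (hbound n m hm hmn ?_)
  have h1 : (1 : ℝ) ≤ m := by exact_mod_cast hm
  have h2 : (α : ℝ) ≤ 1 := by exact_mod_cast hα
  have h3 : (β : ℝ) ≤ 1 := by exact_mod_cast hβ
  unfold chebFreq
  linarith

/-- The weighted Lebesgue functions are not uniformly bounded over `m < n ≤ c m`. -/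
def LebesgueUnbounded (α β : ℕ) (a b c : ℝ) : Prop :=
  ∀ M : ℝ, ∃ n m : ℕ, ∃ t ∈ Ioo 0 π, 0 < m ∧ m < n ∧ (n : ℝ) ≤ c * m ∧
    (∀ k < n, t ≠ chebNode α β n k) ∧ M ≤ lebesgueFun α β a b n m t

theorem LebesgueUnbounded.symm {α β : ℕ} {a b c : ℝ} (h : LebesgueUnbounded α β a b c) :
    LebesgueUnbounded β α b a c := by
  intro M
  obtain ⟨n, m, t, ht, hm, hmn, hc, hne, hM⟩ := h M
  refine ⟨n, m, π - t, ⟨by linarith [ht.2], by linarith [ht.1]⟩, hm, hmn, hc, fun k hk h => ?_, ?_⟩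
  · have h1 := pi_sub_chebNode (α := β) (β := α) hk
    exact hne (n - 1 - k) (by omega) (by rw [← h1]; linarith)
  · rwa [lebesgueFun_pi_sub]

theorem IsChebSystem.not_supLebesgueConst_lt_top {α β : ℕ} {w : ℝ → ℝ} {P : ℕ → ℝ[X]}
    (h : IsChebSystem α β w P) {γ δ c : ℝ}
    (hu : LebesgueUnbounded α β (2 * γ - α) (2 * δ - β) c) :
    ¬ supLebesgueConst w (jacobiWeight γ δ) c < ⊤ := by
  rw [not_lt, top_le_iff]
  refine ENNReal.eq_top_of_forall_nnreal_le fun r => ?_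
  obtain ⟨n, m, t, ht, hm, hmn, hc, hne, hM⟩ := hu r
  calc (r : ℝ≥0∞) = ENNReal.ofReal r := (ENNReal.ofReal_coe_nnreal).symm
    _ ≤ ENNReal.ofReal _ := ENNReal.ofReal_le_ofReal hM
    _ ≤ _ := h.le_lebesgueConst hm hmn γ δ ht hne
    _ ≤ _ := by
      unfold supLebesgueConst
      refine le_iSup_of_le n (le_iSup_of_le m ?_)
      rw [iSup_pos hmn, iSup_pos hc]

theorem ne_chebNode_of_chebTrig_ne_zero {α β n : ℕ} {t : ℝ} (h : chebTrig α β n t ≠ 0) :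
    ∀ k < n, t ≠ chebNode α β n k := by
  rintro k hk rfl
  exact h (chebTrig_chebNode (by omega) k)

theorem sin_le_sin_of_mem {e x : ℝ} (he : -(π / 2) ≤ e) (h1 : e ≤ x) (h2 : x ≤ π - e) :
    sin e ≤ sin x := by
  rcases le_total x (π / 2) with h | h
  · exact sin_le_sin_of_le_of_le_pi_div_two he h h1
  · rw [← sin_pi_sub x]
    exact sin_le_sin_of_le_of_le_pi_div_two he (by linarith) (by linarith)

theorem le_rpow_of_half_le {x b : ℝ} (h1 : 1 / 2 ≤ x) (h2 : x ≤ 1) :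
    min 1 ((1 / 2 : ℝ) ^ b) ≤ x ^ b := by
  rcases le_total 0 b with hb | hb
  · exact (min_le_right _ _).trans (rpow_le_rpow (by norm_num) h1 hb)
  · exact (min_le_left _ _).trans (one_le_rpow_of_pos_of_le_one_of_nonpos (by linarith) h2 hb)

theorem rpow_le_of_half_le {x b : ℝ} (h1 : 1 / 2 ≤ x) (h2 : x ≤ 1) :
    x ^ b ≤ 1 + (1 / 2 : ℝ) ^ b := by
  have h0 : (0 : ℝ) < (1 / 2) ^ b := by positivity
  rcases le_total 0 b with hb | hb
  · linarith [rpow_le_one (by linarith : 0 ≤ x) h2 hb]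
  · linarith [rpow_le_rpow_of_nonpos (by norm_num) h1 hb]

theorem half_le_cos {x : ℝ} (h0 : 0 ≤ x) (h1 : x ≤ π / 3) : 1 / 2 ≤ cos x := by
  rw [← cos_pi_div_three]
  exact cos_le_cos_of_nonneg_of_le_pi h0 (by linarith [pi_pos]) h1

theorem le_lebesgueFun_single {α β n m : ℕ} (a b : ℝ) (hn : 0 < n) {t : ℝ} (ht : t ∈ Ioo 0 π) :
    vpKernel α β n m t (chebNode α β n 0) * (trigWeight a b t / trigWeight a b (chebNode α β n 0))
      ≤ lebesgueFun α β a b n m t := by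
  unfold lebesgueFun
  refine Finset.single_le_sum (f := fun k => vpKernel α β n m t (chebNode α β n k) *
    (trigWeight a b t / trigWeight a b (chebNode α β n k))) (fun k hk => ?_)
    (Finset.mem_range.2 hn)
  exact mul_nonneg (vpKernel_nonneg _ _ _ _ _ _) (div_pos (trigWeight_pos _ _ ht)
    (trigWeight_pos _ _ (chebNode_mem (Finset.mem_range.1 hk)))).le

theorem le_lebesgueFun_of_le_kernel {α β n m : ℕ} {a b κ : ℝ} (hα : α ≤ 1) (hn : 4 ≤ n)
    (ha : 0 ≤ a) (hκ : 0 ≤ κ) {t : ℝ} (ht : t ∈ Ioo 0 π)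
    (hK : κ / chebFreq α β n ^ 2 ≤ vpKernel α β n m t (chebNode α β n 0)) :
    κ / 4 / (1 + (1 / 2 : ℝ) ^ b) * trigWeight a b t * (chebFreq α β n / 2) ^ (a - 2) ≤
      lebesgueFun α β a b n m t := by
  have hN := chebFreq_pos (α := α) (β := β) (by omega : 0 < n)
  have hN4 : 4 ≤ chebFreq α β n := by
    have : (4 : ℝ) ≤ n := by exact_mod_cast hn
    unfold chebFreq
    have : (0 : ℝ) ≤ ((α : ℝ) + β) / 2 := by positivity
    linarith
  have hy := chebNode_mem (α := α) (β := β) (by omega : 0 < n)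
  have hyN := chebFreq_mul_chebNode (α := α) (β := β) (by omega : 0 < n) 0
  refine le_trans ?_ (le_lebesgueFun_single a b (by omega) ht)
  set y := chebNode α β n 0
  set N := chebFreq α β n
  have hα' : (α : ℝ) ≤ 1 := by exact_mod_cast hα
  have hNy : N * y ≤ π := by
    rw [hyN]
    push_cast
    nlinarith [pi_pos]
  have hpi := pi_lt_four
  have hp := pi_pos
  have hy1 : y / 2 ≤ 2 / N := by
    rw [le_div_iff₀ hN]
    linarith
  have hy2 : y / 2 ≤ π / 3 := by nlinarith [hy.1]
  have hs : sin (y / 2) ≤ 2 / N := (sin_le (by linarith [hy.1])).trans hy1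
  have hw : trigWeight a b y ≤ (2 / N) ^ a * (1 + (1 / 2 : ℝ) ^ b) :=
    mul_le_mul (rpow_le_rpow (sin_half_pos hy).le hs ha)
      (rpow_le_of_half_le (half_le_cos (by linarith [hy.1]) hy2) (cos_le_one _))
      (rpow_nonneg (cos_half_pos hy).le _) (by positivity)
  have hwt := trigWeight_pos a b ht
  have hwy := trigWeight_pos a b hy
  calc _ = κ / N ^ 2 * (trigWeight a b t / ((2 / N) ^ a * (1 + (1 / 2 : ℝ) ^ b))) := by
        rw [rpow_sub (by positivity), rpow_two, show (2 / N : ℝ) = (N / 2)⁻¹ by rw [inv_div],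
          inv_rpow (by positivity)]
        field_simp
        norm_num
    _ ≤ κ / N ^ 2 * (trigWeight a b t / trigWeight a b y) :=
        mul_le_mul_of_nonneg_left (div_le_div_of_nonneg_left hwt.le hwy hw) (by positivity)
    _ ≤ _ := mul_le_mul_of_nonneg_right hK (by positivity)

theorem exists_nat_succ_le_mul {c : ℝ} (hc : 1 < c) : ∃ p : ℕ, 0 < p ∧ (p : ℝ) + 1 ≤ c * p := by
  obtain ⟨p, hp⟩ := exists_nat_gt (1 / (c - 1))
  have h1 : 0 < c - 1 := by linarith
  rw [div_lt_iff₀ h1] at hp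
  refine ⟨p, ?_, by linarith⟩
  rcases Nat.eq_zero_or_pos p with rfl | h
  · simp at hp
    linarith
  · exact h

section
variable {α β p j : ℕ}

theorem chebFreq_bounds (hα : α ≤ 1) (hβ : β ≤ 1) (hp : 0 < p) (hj : 0 < j) :
    (j : ℝ) ≤ chebFreq α β (4 * ((p + 1) * j)) ∧
    ((4 * (p * j) : ℕ) : ℝ) ≤ chebFreq α β (4 * ((p + 1) * j)) ∧
    ((4 * (p * j) : ℕ) : ℝ) * (p + 1) ≤ p * chebFreq α β (4 * ((p + 1) * j)) ∧
    chebFreq α β (4 * ((p + 1) * j)) ≤ 3 * ((4 * (p * j) : ℕ) : ℝ) := by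
  have h1 : (α : ℝ) ≤ 1 := by exact_mod_cast hα
  have h2 : (β : ℝ) ≤ 1 := by exact_mod_cast hβ
  have h3 : (1 : ℝ) ≤ p := by exact_mod_cast hp
  have h4 : (1 : ℝ) ≤ j := by exact_mod_cast hj
  have h5 : (0 : ℝ) ≤ α := by positivity
  have h6 : (0 : ℝ) ≤ β := by positivity
  have h7 : (j : ℝ) ≤ p * j := by nlinarith
  unfold chebFreq
  push_cast
  refine ⟨?_, ?_, ?_, ?_⟩
  · nlinarith
  · nlinarith
  · nlinarith
  · nlinarith

theorem mul_chebNode_zero_bounds (hα : α ≤ 1) (hβ : β ≤ 1) (hp : 0 < p) (hj : 0 < j) :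
    π / (6 * (p + 1)) ≤ (4 * (p * j) : ℕ) * chebNode α β (4 * ((p + 1) * j)) 0 ∧
    (4 * (p * j) : ℕ) * chebNode α β (4 * ((p + 1) * j)) 0 ≤ π - π / (p + 1) := by
  obtain ⟨-, -, h3, h4⟩ := chebFreq_bounds hα hβ hp hj
  have hn : 0 < 4 * ((p + 1) * j) := by positivity
  have hN := chebFreq_pos (α := α) (β := β) hn
  have hy := chebFreq_mul_chebNode (α := α) (β := β) hn 0
  have hy0 := chebNode_pos (α := α) (β := β) hn 0
  set y := chebNode α β (4 * ((p + 1) * j)) 0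
  set N := chebFreq α β (4 * ((p + 1) * j))
  set m : ℝ := ((4 * (p * j) : ℕ) : ℝ)
  have hα' : (α : ℝ) ≤ 1 := by exact_mod_cast hα
  have hα0 : (0 : ℝ) ≤ α := by positivity
  have hpi := pi_pos
  have hp' : (1 : ℝ) ≤ p := by exact_mod_cast hp
  push_cast at hy
  constructor
  · have e1 : π / (6 * (p + 1)) ≤ π / 6 := by
      apply div_le_div_of_nonneg_left hpi.le (by norm_num)
      linarith
    have e2 := mul_le_mul_of_nonneg_right h4 hy0.le
    nlinarith
  · have e2 := mul_le_mul_of_nonneg_right h3 hy0.le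
    rw [mul_assoc (p : ℝ), hy] at e2
    have e3 : π - π / (p + 1) = p * π / (p + 1) := by
      field_simp
      ring
    rw [e3, le_div_iff₀ (by positivity)]
    have : (p : ℝ) * ((0 + (α + 1) / 2) * π) ≤ p * π := by
      apply mul_le_mul_of_nonneg_left _ (by positivity)
      nlinarith
    linarith

theorem sin_le_sin_mul_chebNode_zero (hα : α ≤ 1) (hβ : β ≤ 1) (hp : 0 < p) (hj : 0 < j) :
    sin (π / (6 * (p + 1))) ≤
      sin ((4 * (p * j) : ℕ) * chebNode α β (4 * ((p + 1) * j)) 0) := by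
  obtain ⟨h1, h2⟩ := mul_chebNode_zero_bounds hα hβ hp hj
  have hpi := pi_pos
  have h3 : π / (6 * (p + 1)) ≤ π / (p + 1) :=
    div_le_div_of_nonneg_left hpi.le (by positivity) (by linarith [(p.cast_nonneg : (0 : ℝ) ≤ p)])
  exact sin_le_sin_of_mem (by linarith [(by positivity : 0 < π / (6 * ((p : ℝ) + 1)))]) h1
    (by linarith)

end

theorem le_div_sq_sin {x θ : ℝ} (hx : 0 ≤ x) (h : sin θ ≠ 0) : x ≤ x / sin θ ^ 2 := by
  rw [le_div_iff₀ (by positivity)]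
  exact mul_le_of_le_one_right hx (sin_sq_le_one θ)

theorem sin_four_mul_add {i : ℕ} (x : ℝ) : sin ((4 * i : ℕ) * (π / 2 + x)) =
    sin ((4 * i : ℕ) * x) := by
  rw [show ((4 * i : ℕ) : ℝ) * (π / 2 + x) = (4 * i : ℕ) * x + i * (2 * π) by push_cast; ring,
    sin_add_nat_mul_two_pi]

theorem half_le_abs_chebTrig_pi_div_two {α β i : ℕ} (hα : α ≤ 1) (hβ : β ≤ 1) :
    1 / 2 ≤ |chebTrig α β (4 * i) (π / 2)| := by
  have h1 : chebTrig α β (4 * i) (π / 2) = cos (((β : ℝ) - α) * (π / 4)) := by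
    rw [chebTrig, chebFreq, ← cos_sub_nat_mul_two_pi _ i]
    congr 1
    push_cast
    ring
  have h2 : 1 / 2 ≤ cos (π / 4) := half_le_cos (by linarith [pi_pos]) (by linarith [pi_pos])
  rw [h1]
  refine le_trans ?_ (le_abs_self _)
  interval_cases α <;> interval_cases β <;> norm_num <;> norm_num at h2 <;> exact h2

theorem two_mul_le_abs_vpBracket_pi_div_two {i : ℕ} {y : ℝ} (hy : y ∈ Ioo 0 (π / 2))
    (h : 0 ≤ sin ((4 * i : ℕ) * y)) :
    2 * sin ((4 * i : ℕ) * y) ≤ |vpBracket (4 * i) (π / 2) y| := by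
  have hpi := pi_pos
  have ht : π / 2 ∈ Ioo 0 π := ⟨by linarith, by linarith⟩
  have hy' : y ∈ Ioo 0 π := ⟨hy.1, by linarith [hy.2]⟩
  have h1 := le_div_sq_sin h (sin_half_sub_ne_zero ht hy' hy.2.ne')
  have h2 := le_div_sq_sin h (sin_half_add_pos ht hy').ne'
  have h3 : vpBracket (4 * i) (π / 2) y = -(sin ((4 * i : ℕ) * y) / sin ((π / 2 - y) / 2) ^ 2 +
      sin ((4 * i : ℕ) * y) / sin ((π / 2 + y) / 2) ^ 2) := by
    unfold vpBracket
    rw [sin_four_mul_add, sub_eq_add_neg (π / 2) y, sin_four_mul_add, mul_neg, sin_neg]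
    ring
  rw [h3, abs_neg]
  exact le_trans (by linarith) (le_abs_self _)

theorem two_mul_le_abs_vpBracket_pi_sub {i : ℕ} {s y : ℝ} (hs : 0 < s) (hsy : s ≤ y)
    (h : y + s < π) (h1 : (4 * i : ℕ) * (y + s) ≤ π) :
    2 * (sin ((4 * i : ℕ) * y) * cos ((4 * i : ℕ) * s)) ≤ |vpBracket (4 * i) (π - s) y| := by
  have hpi := pi_pos
  have ht : π - s ∈ Ioo 0 π := ⟨by linarith, by linarith⟩
  have hy' : y ∈ Ioo 0 π := ⟨by linarith, by linarith⟩
  have hi : (0 : ℝ) ≤ (4 * i : ℕ) := by positivity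
  have e1 : 0 ≤ sin ((4 * i : ℕ) * (y + s)) :=
    sin_nonneg_of_nonneg_of_le_pi (mul_nonneg hi (by linarith)) h1
  have e2 : 0 ≤ sin ((4 * i : ℕ) * (y - s)) :=
    sin_nonneg_of_nonneg_of_le_pi (mul_nonneg hi (by linarith))
      ((mul_le_mul_of_nonneg_left (by linarith) hi).trans h1)
  have f1 := le_div_sq_sin e1 (sin_half_sub_ne_zero ht hy' (by linarith : π - s > y).ne')
  have f2 := le_div_sq_sin e2 (sin_half_add_pos ht hy').ne'
  have h3 : vpBracket (4 * i) (π - s) y =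
      -(sin ((4 * i : ℕ) * (y + s)) / sin ((π - s - y) / 2) ^ 2 +
      sin ((4 * i : ℕ) * (y - s)) / sin ((π - s + y) / 2) ^ 2) := by
    unfold vpBracket
    rw [show π - s - y = π / 2 + (π / 2 + -(y + s)) by ring, sin_four_mul_add, sin_four_mul_add,
      mul_neg, sin_neg, show π - s + y = π / 2 + (π / 2 + (y - s)) by ring, sin_four_mul_add,
      sin_four_mul_add]
    ring
  rw [h3, abs_neg]
  refine le_trans ?_ (le_abs_self _)
  have h4 : 2 * (sin ((4 * i : ℕ) * y) * cos ((4 * i : ℕ) * s)) =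
      sin ((4 * i : ℕ) * (y + s)) + sin ((4 * i : ℕ) * (y - s)) := by
    rw [mul_add, mul_sub, sin_add, sin_sub]
    ring
  linarith

theorem exists_le_mul_rpow {κ s : ℝ} (hκ : 0 < κ) (hs : 0 < s) (M : ℝ) :
    ∃ j : ℕ, 0 < j ∧ ∀ x : ℝ, (j : ℝ) ≤ x → M ≤ κ * (x / 2) ^ s := by
  have h : Filter.Tendsto (fun x : ℝ => κ * (x / 2) ^ s) Filter.atTop Filter.atTop :=
    ((tendsto_rpow_atTop hs).comp
      (Filter.tendsto_id.atTop_div_const two_pos)).const_mul_atTop hκ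
  obtain ⟨X, hX⟩ := Filter.eventually_atTop.1 (h.eventually_ge_atTop M)
  obtain ⟨j, hj⟩ := exists_nat_ge X
  refine ⟨j + 1, by omega, fun x hx => hX x ?_⟩
  push_cast at hx
  linarith

theorem le_vpKernel_of_le {α β n m : ℕ} {t y κ : ℝ} (hm : 0 < m) (hn : 0 < n)
    (hmN : (m : ℝ) ≤ chebFreq α β n) (hκ : κ ≤ |chebTrig α β n t * vpBracket m t y|) : κ / 4 / chebFreq α β n ^ 2 ≤ vpKernel α β n m t y := by
  have hN := chebFreq_pos (α := α) (β := β) hn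
  unfold vpKernel
  rw [div_div]
  refine div_le_div₀ (abs_nonneg _) hκ (by positivity) ?_
  nlinarith

theorem lebesgueUnbounded_of_two_lt {α β : ℕ} {a b c : ℝ} (hα : α ≤ 1) (hβ : β ≤ 1)
    (hc : 1 < c) (ha : 2 < a) : LebesgueUnbounded α β a b c := by
  intro M
  obtain ⟨p, hp, hpc⟩ := exists_nat_succ_le_mul hc
  have hpi := pi_pos
  have ht : π / 2 ∈ Ioo 0 π := ⟨by linarith, by linarith⟩
  have he : 0 < π / (6 * ((p : ℝ) + 1)) := by positivity
  have he' : π / (6 * ((p : ℝ) + 1)) < π := by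
    rw [div_lt_iff₀ (by positivity)]
    nlinarith [(p.cast_nonneg : (0 : ℝ) ≤ p)]
  have hse : 0 < sin (π / (6 * ((p : ℝ) + 1))) := sin_pos_of_pos_of_lt_pi he he'
  set σ := sin (π / (6 * ((p : ℝ) + 1)))
  have hW := trigWeight_pos a b ht
  obtain ⟨j, hj, hjM⟩ := exists_le_mul_rpow (κ := σ / 4 / 4 / (1 + (1 / 2 : ℝ) ^ b) *
    trigWeight a b (π / 2)) (s := a - 2) (by positivity) (by linarith) M
  obtain ⟨h1, h2, h3, h4⟩ := chebFreq_bounds hα hβ hp hj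
  have hs := sin_le_sin_mul_chebNode_zero hα hβ hp hj
  have hφ := half_le_abs_chebTrig_pi_div_two (i := (p + 1) * j) hα hβ
  have hn : 0 < 4 * ((p + 1) * j) := by positivity
  have hm : 0 < 4 * (p * j) := by positivity
  have hn8 : 8 ≤ 4 * ((p + 1) * j) := by nlinarith
  have hN := chebFreq_pos (α := α) (β := β) hn
  refine ⟨4 * ((p + 1) * j), 4 * (p * j), π / 2, ht, hm, by nlinarith, ?_,
    ne_chebNode_of_chebTrig_ne_zero fun h0 => ?_, ?_⟩
  · push_cast
    nlinarith [(j.cast_nonneg : (0 : ℝ) ≤ j)]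
  · rw [h0] at hφ
    norm_num at hφ
  · refine (hjM _ h1).trans (le_lebesgueFun_of_le_kernel hα (by omega) (by linarith)
      (by positivity) ht ?_)
    refine le_vpKernel_of_le hm hn h2 ?_
    have hy0 := chebNode_pos (α := α) (β := β) hn 0
    have hy := chebFreq_mul_chebNode (α := α) (β := β) hn 0
    have hB := two_mul_le_abs_vpBracket_pi_div_two (i := p * j)
      (y := chebNode α β (4 * ((p + 1) * j)) 0) ⟨hy0, by
        have h8 : (8 : ℝ) ≤ chebFreq α β (4 * ((p + 1) * j)) := by
          have : (8 : ℝ) ≤ (4 * ((p + 1) * j) : ℕ) := by exact_mod_cast hn8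
          unfold chebFreq
          have : (0 : ℝ) ≤ ((α : ℝ) + β) / 2 := by positivity
          linarith
        have hα' : (α : ℝ) ≤ 1 := by exact_mod_cast hα
        push_cast at hy
        nlinarith⟩ (hse.le.trans hs)
    rw [abs_mul]
    nlinarith [abs_nonneg (vpBracket (4 * (p * j)) (π / 2) (chebNode α β (4 * ((p + 1) * j)) 0))]

theorem le_trigWeight_pi_sub {a b s N : ℝ} (ha : 0 ≤ a) (hb : b ≤ 0) (hN : 0 < N) (hs : 0 < s)
    (hs1 : s ≤ 1) (hsN : s / 2 ≤ 2 / N) :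
    (1 / 2 : ℝ) ^ a * (N / 2) ^ (-b) ≤ trigWeight a b (π - s) := by
  have hpi := pi_gt_three
  have hs2 : 0 < s / 2 := by positivity
  have ht : π - s ∈ Ioo 0 π := ⟨by linarith, by linarith⟩
  have w1 : (1 / 2 : ℝ) ^ a ≤ sin ((π - s) / 2) ^ a := by
    refine rpow_le_rpow (by norm_num) ?_ ha
    rw [show (π - s) / 2 = π / 2 - s / 2 by ring, sin_pi_div_two_sub]
    exact half_le_cos hs2.le (by linarith)
  have w2 : (N / 2) ^ (-b) ≤ cos ((π - s) / 2) ^ b := by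
    rw [show (π - s) / 2 = π / 2 - s / 2 by ring, cos_pi_div_two_sub, rpow_neg (by positivity),
      ← inv_rpow (by positivity), inv_div]
    exact rpow_le_rpow_of_nonpos (sin_pos_of_pos_of_lt_pi hs2 (by linarith))
      ((sin_le hs2.le).trans hsN) hb
  exact mul_le_mul w1 w2 (by positivity) (rpow_nonneg (sin_half_pos ht).le _)

set_option maxHeartbeats 1000000 in
theorem lebesgueUnbounded_of_two_lt_sub {α : ℕ} {a b c : ℝ} (hα : α ≤ 1)
    (hc : 1 < c) (hb1 : -1 ≤ b) (hb : b < 0) (hab : 2 < a - b) : LebesgueUnbounded α 1 a b c := by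
  intro M
  obtain ⟨p, hp, hpc⟩ := exists_nat_succ_le_mul hc
  have hpi := pi_pos
  set e := π / (6 * ((p : ℝ) + 1)) with he_def
  have hp0 : (1 : ℝ) ≤ p := by exact_mod_cast hp
  have he : 0 < e := by positivity
  have he12 : e ≤ π / 12 := by
    apply div_le_div_of_nonneg_left hpi.le (by norm_num)
    linarith
  have hse : 0 < sin e := sin_pos_of_pos_of_lt_pi he (by linarith)
  have hcos : (0 : ℝ) < (1 / 2) ^ a := by positivity
  obtain ⟨j, hj, hjM⟩ := exists_le_mul_rpow (κ := sin e * sin e / 4 / 4 / (1 + (1 / 2 : ℝ) ^ b) *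
    (1 / 2) ^ a) (s := a - b - 2) (by positivity) (by linarith) M
  obtain ⟨h1, h2, h3, h4⟩ := chebFreq_bounds hα le_rfl hp hj
  have hs := sin_le_sin_mul_chebNode_zero hα le_rfl hp hj
  obtain ⟨-, hy2⟩ := mul_chebNode_zero_bounds hα le_rfl hp hj
  have hn : 0 < 4 * ((p + 1) * j) := by positivity
  have hm : 0 < 4 * (p * j) := by positivity
  have hn8 : 8 ≤ 4 * ((p + 1) * j) := by nlinarith
  have hN := chebFreq_pos (α := α) (β := 1) hn
  have hy0 := chebNode_pos (α := α) (β := 1) hn 0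
  have hyN := chebFreq_mul_chebNode (α := α) (β := 1) hn 0
  have h8 : (8 : ℝ) ≤ chebFreq α 1 (4 * ((p + 1) * j)) := by
    have : (8 : ℝ) ≤ (4 * ((p + 1) * j) : ℕ) := by exact_mod_cast hn8
    unfold chebFreq
    have : (0 : ℝ) ≤ ((α : ℝ) + (1 : ℕ)) / 2 := by positivity
    linarith
  have hm1 : (1 : ℝ) ≤ (4 * (p * j) : ℕ) := by exact_mod_cast hm
  have hK := fun t => le_vpKernel_of_le (α := α) (β := 1) (t := t)
    (y := chebNode α 1 (4 * ((p + 1) * j)) 0) (κ := sin e * sin e) hm hn h2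
  have hL := fun t ht => le_lebesgueFun_of_le_kernel (β := 1) (m := 4 * (p * j)) (a := a)
    (b := b) (κ := sin e * sin e / 4) (t := t)
    hα (by omega : 4 ≤ 4 * ((p + 1) * j)) (by linarith) (by positivity) ht
  have hα0 : (0 : ℝ) ≤ α := by positivity
  have hα1 : (α : ℝ) ≤ 1 := by exact_mod_cast hα
  have hjM' := hjM _ h1
  have hmn : 4 * (p * j) < 4 * ((p + 1) * j) := by nlinarith
  have hφ : ∀ s, |chebTrig α 1 (4 * ((p + 1) * j)) (π - s)| =
      |sin (chebFreq α 1 (4 * ((p + 1) * j)) * s)| := by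
    intro s
    rw [abs_chebTrig_pi_sub, abs_chebTrig_one, chebFreq_comm α 1]
  have hB := fun s => two_mul_le_abs_vpBracket_pi_sub (i := p * j) (s := s)
    (y := chebNode α 1 (4 * ((p + 1) * j)) 0)
  have hcm : ((4 * ((p + 1) * j) : ℕ) : ℝ) ≤ c * (4 * (p * j) : ℕ) := by
    push_cast
    nlinarith [(j.cast_nonneg : (0 : ℝ) ≤ j)]
  have hnode := fun t => ne_chebNode_of_chebTrig_ne_zero (α := α) (β := 1)
    (n := 4 * ((p + 1) * j)) (t := t)
  refine ⟨4 * ((p + 1) * j), 4 * (p * j), ?_⟩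
  generalize 4 * ((p + 1) * j) = n at *
  generalize 4 * (p * j) = m at *
  set N := chebFreq α 1 n
  set y := chebNode α 1 n 0
  push_cast at hyN
  have hsN : N * (e / N) = e := mul_div_cancel₀ _ hN.ne'
  set s := e / N
  have hs0 : 0 < s := by positivity
  have hsy : s ≤ y := by
    refine le_of_mul_le_mul_left ?_ hN
    rw [hsN, hyN]
    nlinarith
  have hyle : N * y ≤ π := by
    rw [hyN]
    nlinarith
  have hys : y + s < π := by
    have : N * (y + s) < N * π := by
      rw [mul_add, hsN]
      nlinarith
    exact lt_of_mul_lt_mul_left this hN.le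
  have hms : m * s ≤ e := by
    rw [← hsN]
    exact mul_le_mul_of_nonneg_right h2 hs0.le
  have hmys : m * (y + s) ≤ π := by
    have : e ≤ π / (p + 1) := by
      apply div_le_div_of_nonneg_left hpi.le (by positivity)
      linarith
    rw [mul_add]
    linarith
  have ht : π - s ∈ Ioo 0 π := ⟨by linarith, by linarith⟩
  have hB := hB s hs0 hsy hys hmys
  have hcosm : 1 / 2 ≤ cos (m * s) := half_le_cos (by positivity) (by linarith)
  have hφs : |chebTrig α 1 n (π - s)| = sin e := by
    rw [hφ, hsN, abs_of_pos hse]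
  refine ⟨π - s, ht, hm, hmn, hcm, hnode _ fun h0 => ?_, hjM'.trans (le_trans ?_ (hL _ ht
    (hK _ ?_)))⟩
  · rw [h0, abs_zero] at hφs
    exact hse.ne hφs
  · have w3 := le_trigWeight_pi_sub (a := a) (b := b) (by linarith) hb.le hN hs0 (by
      have := pi_lt_four
      nlinarith) (by
      rw [le_div_iff₀ hN]
      have := pi_lt_four
      linarith)
    have w4 : (N / 2) ^ (a - b - 2) = (N / 2) ^ (-b) * (N / 2) ^ (a - 2) := by
      rw [← rpow_add (by positivity)]
      ring_nf
    rw [w4]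
    have w5 : 0 ≤ sin e * sin e / 4 / 4 / (1 + (1 / 2 : ℝ) ^ b) := by positivity
    have w6 : 0 ≤ (N / 2) ^ (a - 2) := by positivity
    have w7 := mul_le_mul_of_nonneg_right (mul_le_mul_of_nonneg_left w3 w5) w6
    refine le_trans (le_of_eq ?_) w7
    ring
  · rw [abs_mul, hφs]
    refine mul_le_mul_of_nonneg_left (le_trans ?_ hB) hse.le
    nlinarith

theorem sum_range_two_mul (g : ℕ → ℝ) (j : ℕ) :
    ∑ k ∈ Finset.range (2 * j), g k = ∑ i ∈ Finset.range j, (g (2 * i) + g (2 * i + 1)) := by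
  induction j with
  | zero => simp
  | succ j ih =>
    rw [show 2 * (j + 1) = 2 * j + 1 + 1 by ring, Finset.sum_range_succ, Finset.sum_range_succ,
      Finset.sum_range_succ, ih, add_assoc]

theorem abs_sin_sub_le (x y : ℝ) : |sin (x - y)| ≤ |sin x| + |sin y| := by
  rw [sin_sub]
  refine (abs_sub _ _).trans (add_le_add ?_ ?_)
  · rw [abs_mul]
    exact mul_le_of_le_one_right (abs_nonneg _) (abs_cos_le_one _)
  · rw [abs_mul]
    exact mul_le_of_le_one_left (abs_nonneg _) (abs_cos_le_one _)

theorem harmonic_le_sum_abs_sin (θ : ℝ) (j : ℕ) :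
    |sin θ| / 2 * ∑ i ∈ Finset.range j, 1 / ((i : ℝ) + 1) ≤
      ∑ k ∈ Finset.range (2 * j), |sin (((k : ℝ) + 1) * θ)| / (k + 1) := by
  rw [sum_range_two_mul, Finset.mul_sum]
  refine Finset.sum_le_sum fun i _ => ?_
  push_cast
  have h := abs_sin_sub_le ((2 * i + 1 + 1) * θ) ((2 * i + 1) * θ)
  rw [show (2 * (i : ℝ) + 1 + 1) * θ - (2 * i + 1) * θ = θ by ring] at h
  have h1 : |sin ((2 * (i : ℝ) + 1) * θ)| / (2 * i + 1 + 1) ≤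
      |sin ((2 * (i : ℝ) + 1) * θ)| / (2 * i + 1) :=
    div_le_div_of_nonneg_left (abs_nonneg _) (by positivity) (by linarith)
  calc |sin θ| / 2 * (1 / (i + 1)) = |sin θ| / (2 * i + 1 + 1) := by
        field_simp
        ring
    _ ≤ (|sin ((2 * i + 1 + 1) * θ)| + |sin ((2 * i + 1) * θ)|) / (2 * i + 1 + 1) :=
        div_le_div_of_nonneg_right h (by positivity)
    _ ≤ _ := by
        rw [add_div]
        linarith

theorem tendsto_abs_vpBracket_zero (m : ℕ) {y : ℝ} (hy : y ∈ Ioo 0 π) :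
    Filter.Tendsto (fun t => |vpBracket m t y|) (𝓝[>] 0)
      (𝓝 (2 * |sin (m * y)| / sin (y / 2) ^ 2)) := by
  have hs := sin_half_pos hy
  have h1 : |vpBracket m 0 y| = 2 * |sin (m * y)| / sin (y / 2) ^ 2 := by
    unfold vpBracket
    rw [zero_sub, zero_add, mul_neg, sin_neg, neg_div 2 y, sin_neg, neg_sq, ← sub_div, abs_div,
      abs_of_pos (a := sin (y / 2) ^ 2) (by positivity),
      show -sin (m * y) - sin (m * y) = -(2 * sin (m * y)) by ring, abs_neg, abs_mul, abs_two]
  rw [← h1]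
  refine Filter.Tendsto.mono_left (ContinuousAt.tendsto ?_) nhdsWithin_le_nhds
  unfold vpBracket
  refine ContinuousAt.abs (ContinuousAt.sub (ContinuousAt.div (by fun_prop) (by fun_prop) ?_)
    (ContinuousAt.div (by fun_prop) (by fun_prop) ?_))
  · rw [zero_sub, neg_div, sin_neg, neg_sq]
    positivity
  · rw [zero_add]
    positivity

theorem le_trigWeight_mul_abs_sin {b N t : ℝ} (hN : 1 ≤ N) (ht : 0 < t) (htN : t ≤ 1 / N) :
    2 * N / π * min 1 ((1 / 2 : ℝ) ^ b) ≤ trigWeight (-1) b t * |sin (N * t)| := by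
  have hpi := pi_gt_three
  have ht1 : t ≤ 1 := htN.trans (by rw [div_le_one (by linarith)]; exact hN)
  have hNt : N * t ≤ 1 := by
    rw [le_div_iff₀ (by linarith)] at htN
    linarith
  have htm : t ∈ Ioo 0 π := ⟨ht, by linarith⟩
  have h1 := mul_le_sin (x := N * t) (by positivity) (by linarith)
  have h2 := le_rpow_of_half_le (b := b)
    (half_le_cos (by positivity : 0 ≤ t / 2) (by linarith)) (cos_le_one _)
  have h3 := sin_half_pos htm
  have h4 : 1 / t ≤ sin (t / 2) ^ (-1 : ℝ) := by
    rw [rpow_neg_one, one_div]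
    exact inv_anti₀ h3 ((sin_le (by positivity)).trans (by linarith))
  have h5 : (0 : ℝ) ≤ min 1 ((1 / 2 : ℝ) ^ b) := by positivity
  unfold trigWeight
  calc 2 * N / π * min 1 ((1 / 2 : ℝ) ^ b) = 1 / t * min 1 ((1 / 2 : ℝ) ^ b) *
        (2 / π * (N * t)) := by
        field_simp
    _ ≤ _ := mul_le_mul (mul_le_mul h4 h2 h5 (by positivity)) (h1.trans (le_abs_self _))
        (by positivity) (mul_nonneg (by positivity) (rpow_nonneg (cos_half_pos htm).le _))

theorem one_div_le_of_node {b : ℝ} {β n k : ℕ} (hkn : 2 * (k + 1) ≤ n) :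
    chebFreq 1 β n / (k + 1) * (1 / (2 * (1 + (1 / 2 : ℝ) ^ b))) ≤
      1 / (sin (chebNode 1 β n k / 2) ^ 2 * trigWeight (-1) b (chebNode 1 β n k)) := by
  have hn : 0 < n := by omega
  have hN := chebFreq_pos (α := 1) (β := β) hn
  have hy := chebNode_mem (α := 1) (β := β) (by omega : k < n)
  have hyN := chebFreq_mul_chebNode (α := 1) (β := β) hn k
  have hNn : (n : ℝ) ≤ chebFreq 1 β n := by
    unfold chebFreq
    have : (0 : ℝ) ≤ ((1 : ℕ) + (β : ℝ)) / 2 := by positivity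
    linarith
  set y := chebNode 1 β n k
  set N := chebFreq 1 β n
  have hs := sin_half_pos hy
  have hc := cos_half_pos hy
  have hkn' : 2 * ((k : ℝ) + 1) ≤ N := by
    refine le_trans ?_ hNn
    exact_mod_cast hkn
  push_cast at hyN
  have hpi := pi_pos
  have hy2 : y / 2 ≤ π / 3 := by
    have : N * y ≤ N * (π / 2) := by
      rw [hyN]
      nlinarith
    have := le_of_mul_le_mul_left this hN
    linarith
  have h1 := rpow_le_of_half_le (b := b) (half_le_cos (by linarith [hy.1]) hy2) (cos_le_one _)
  have h2 : sin (y / 2) ≤ 2 * (k + 1) / N := by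
    refine (sin_le (by linarith [hy.1])).trans ?_
    rw [le_div_iff₀ hN]
    have := pi_lt_four
    nlinarith [(k.cast_nonneg : (0 : ℝ) ≤ k)]
  have h3 : sin (y / 2) ^ 2 * trigWeight (-1) b y ≤
      2 * (k + 1) / N * (1 + (1 / 2 : ℝ) ^ b) := by
    unfold trigWeight
    rw [rpow_neg_one, show ∀ u v : ℝ, u ^ 2 * (u⁻¹ * v) = (u * u⁻¹) * u * v by intros; ring,
      mul_inv_cancel₀ hs.ne', one_mul]
    exact mul_le_mul h2 h1 (rpow_nonneg hc.le _) (by positivity)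
  refine le_trans (le_of_eq ?_) (div_le_div_of_nonneg_left zero_le_one
    (mul_pos (by positivity) (trigWeight_pos _ _ hy)) h3)
  field_simp

theorem lebesgueUnbounded_of_eq_neg_one {β : ℕ} {b c : ℝ} (hβ : β ≤ 1) (hc : 1 < c) :
    LebesgueUnbounded 1 β (-1) b c := by
  intro M
  obtain ⟨p, hp, hpc⟩ := exists_nat_succ_le_mul hc
  have hpi := pi_pos
  set e := π / (6 * ((p : ℝ) + 1)) with he_def
  have hp0 : (1 : ℝ) ≤ p := by exact_mod_cast hp
  have he : 0 < e := by positivity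
  have he12 : e ≤ π / 12 := by
    apply div_le_div_of_nonneg_left hpi.le (by norm_num)
    linarith
  have hse : 0 < sin e := sin_pos_of_pos_of_lt_pi he (by linarith)
  set D := min 1 ((1 / 2 : ℝ) ^ b) with hD
  have hD0 : 0 < D := by positivity
  set E := 1 / (2 * (1 + (1 / 2 : ℝ) ^ b)) with hE
  have hE0 : 0 < E := by positivity
  set κ := D * E * sin e / (2 * π) with hκ
  have hκ0 : 0 < κ := by positivity
  obtain ⟨j, hj, hjM⟩ : ∃ j : ℕ, 0 < j ∧
      M < κ * ∑ i ∈ Finset.range j, 1 / ((i : ℝ) + 1) := by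
    have h := (Real.tendsto_sum_range_one_div_nat_succ_atTop.const_mul_atTop hκ0)
    obtain ⟨j, hj1, hj2⟩ := ((h.eventually_gt_atTop M).and (Filter.eventually_gt_atTop 0)).exists
    exact ⟨j, hj2, hj1⟩
  obtain ⟨h1, h2, h3, h4⟩ := chebFreq_bounds le_rfl hβ hp hj
  have hs := sin_le_sin_mul_chebNode_zero le_rfl hβ hp hj
  have hn : 0 < 4 * ((p + 1) * j) := by positivity
  have hm : 0 < 4 * (p * j) := by positivity
  have hjn : 2 * (2 * j) ≤ 4 * ((p + 1) * j) := by nlinarith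
  have hmn : 4 * (p * j) < 4 * ((p + 1) * j) := by nlinarith
  have hcm : ((4 * ((p + 1) * j) : ℕ) : ℝ) ≤ c * (4 * (p * j) : ℕ) := by
    push_cast
    nlinarith [(j.cast_nonneg : (0 : ℝ) ≤ j)]
  refine ⟨4 * ((p + 1) * j), 4 * (p * j), ?_⟩
  generalize 4 * ((p + 1) * j) = n at *
  generalize 4 * (p * j) = m at *
  have hN := chebFreq_pos (α := 1) (β := β) hn
  have hN1 : 1 ≤ chebFreq 1 β n := by
    have : (1 : ℝ) ≤ j := by exact_mod_cast hj
    linarith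
  set N := chebFreq 1 β n with hNdef
  have hm0 : (0 : ℝ) < m := by exact_mod_cast hm
  set S : ℝ → ℝ := fun t => ∑ k ∈ Finset.range n,
    |vpBracket m t (chebNode 1 β n k)| / trigWeight (-1) b (chebNode 1 β n k) with hS
  set S0 : ℝ := ∑ k ∈ Finset.range n, 2 * |sin (m * chebNode 1 β n k)| /
    sin (chebNode 1 β n k / 2) ^ 2 / trigWeight (-1) b (chebNode 1 β n k) with hS0
  have hlim : Filter.Tendsto S (𝓝[>] 0) (𝓝 S0) := by
    refine tendsto_finsetSum _ fun k hk => ?_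
    exact (tendsto_abs_vpBracket_zero m
      (chebNode_mem (Finset.mem_range.1 hk))).div_const _
  have hlow : N * E * (sin e * ∑ i ∈ Finset.range j, 1 / ((i : ℝ) + 1)) ≤ S0 := by
    have g1 := harmonic_le_sum_abs_sin (m * chebNode 1 β n 0) j
    have g2 : sin e ≤ |sin (m * chebNode 1 β n 0)| := hs.trans (le_abs_self _)
    have g3 : (0 : ℝ) ≤ ∑ i ∈ Finset.range j, 1 / ((i : ℝ) + 1) :=
      Finset.sum_nonneg fun i _ => by positivity
    have g4 : ∀ k : ℕ, (((k : ℝ) + 1) * (m * chebNode 1 β n 0)) = m * chebNode 1 β n k := by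
      intro k
      unfold chebNode
      push_cast
      ring
    calc _ ≤ N * E * (2 * ∑ k ∈ Finset.range (2 * j),
          |sin (((k : ℝ) + 1) * (m * chebNode 1 β n 0))| / (k + 1)) := by
          refine mul_le_mul_of_nonneg_left ?_ (by positivity)
          have := mul_le_mul_of_nonneg_right g2 g3
          linarith
      _ ≤ ∑ k ∈ Finset.range (2 * j), 2 * |sin (m * chebNode 1 β n k)| /
          sin (chebNode 1 β n k / 2) ^ 2 / trigWeight (-1) b (chebNode 1 β n k) := by
          rw [Finset.mul_sum, Finset.mul_sum]
          refine Finset.sum_le_sum fun k hk => ?_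
          have hk := Finset.mem_range.1 hk
          rw [g4]
          have g5 := mul_le_mul_of_nonneg_left (one_div_le_of_node (b := b) (β := β) (n := n)
            (k := k) (by omega)) (by positivity : 0 ≤ 2 * |sin (m * chebNode 1 β n k)|)
          refine le_trans (le_of_eq ?_) (g5.trans (le_of_eq ?_))
          · ring
          · rw [div_div, mul_one_div]
      _ ≤ S0 := by
          refine Finset.sum_le_sum_of_subset_of_nonneg (fun k hk => ?_) fun k hk _ => ?_
          · rw [Finset.mem_range] at hk ⊢
            omega
          · have := trigWeight_pos (-1) b (chebNode_mem (α := 1) (β := β) (Finset.mem_range.1 hk))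
            positivity
  have hκS : M < D / (2 * π * m) * S0 := by
    refine hjM.trans_le ?_
    have g3 : (0 : ℝ) ≤ ∑ i ∈ Finset.range j, 1 / ((i : ℝ) + 1) :=
      Finset.sum_nonneg fun i _ => by positivity
    calc κ * ∑ i ∈ Finset.range j, 1 / ((i : ℝ) + 1) = D / (2 * π * m) *
          (m * E * (sin e * ∑ i ∈ Finset.range j, 1 / ((i : ℝ) + 1))) := by
          rw [hκ]
          field_simp
      _ ≤ D / (2 * π * m) * (N * E * (sin e * ∑ i ∈ Finset.range j, 1 / ((i : ℝ) + 1))) := by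
          refine mul_le_mul_of_nonneg_left (mul_le_mul_of_nonneg_right
            (mul_le_mul_of_nonneg_right h2 hE0.le) (by positivity)) (by positivity)
      _ ≤ _ := mul_le_mul_of_nonneg_left hlow (by positivity)
  have hev := (hlim.const_mul (D / (2 * π * m))).eventually_const_lt hκS
  have hev2 : ∀ᶠ t in 𝓝[>] (0 : ℝ), t ∈ Ioo 0 (1 / N) :=
    Ioo_mem_nhdsGT (by positivity)
  obtain ⟨t, htS, ht0, htN⟩ := (hev.and hev2).exists
  have ht1 : t < 1 := htN.trans_le (by rw [div_le_one hN]; exact hN1)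
  have hpi3 := pi_gt_three
  have ht : t ∈ Ioo 0 π := ⟨ht0, by linarith⟩
  have hw := le_trigWeight_mul_abs_sin (b := b) hN1 ht0 htN.le
  refine ⟨t, ht, hm, hmn, hcm, ne_chebNode_of_chebTrig_ne_zero fun h0 => ?_, htS.le.trans ?_⟩
  · rw [← abs_eq_zero, abs_chebTrig_one] at h0
    rw [← hNdef] at h0
    rw [h0, mul_zero] at hw
    have : 0 < 2 * N / π * D := by positivity
    linarith
  · have hSn : 0 ≤ S t := Finset.sum_nonneg fun k hk => by
      have := trigWeight_pos (-1) b (chebNode_mem (α := 1) (β := β) (Finset.mem_range.1 hk))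
      positivity
    have hL : lebesgueFun 1 β (-1) b n m t =
        trigWeight (-1) b t * |sin (N * t)| / (4 * m * N) * S t := by
      unfold lebesgueFun
      rw [hS, Finset.mul_sum]
      refine Finset.sum_congr rfl fun k _ => ?_
      unfold vpKernel
      rw [abs_mul, abs_chebTrig_one]
      ring
    rw [hL]
    refine mul_le_mul_of_nonneg_right ?_ hSn
    calc D / (2 * π * m) = 2 * N / π * D / (4 * m * N) := by
          field_simp
          norm_num
      _ ≤ _ := div_le_div_of_nonneg_right hw (by positivity)

theorem lebesgueUnbounded_of_not {α β : ℕ} {γ δ c : ℝ} (hα : α ≤ 1) (hβ : β ≤ 1) (hγ : 0 ≤ γ)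
    (hδ : 0 ≤ δ) (hc : 1 < c)
    (h : ¬ ((-1 < 2 * γ - α ∧ 2 * γ - α ≤ 2) ∧ (-1 < 2 * δ - β ∧ 2 * δ - β ≤ 2) ∧
      |2 * γ - α - (2 * δ - β)| ≤ 2)) :
    LebesgueUnbounded α β (2 * γ - α) (2 * δ - β) c := by
  have hα' : (α : ℝ) ≤ 1 := by exact_mod_cast hα
  have hβ' : (β : ℝ) ≤ 1 := by exact_mod_cast hβ
  rcases lt_or_ge 2 (2 * γ - α) with ha2 | ha2
  · exact lebesgueUnbounded_of_two_lt hα hβ hc ha2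
  rcases lt_or_ge 2 (2 * δ - β) with hb2 | hb2
  · exact (lebesgueUnbounded_of_two_lt hβ hα hc hb2).symm
  rcases le_or_gt (2 * γ - α) (-1) with ha | ha
  · obtain rfl : α = 1 := by
      by_contra h1
      obtain rfl : α = 0 := by omega
      push_cast at ha
      linarith
    rw [show 2 * γ - (1 : ℕ) = -1 by push_cast at ha ⊢; linarith]
    exact lebesgueUnbounded_of_eq_neg_one hβ hc
  rcases le_or_gt (2 * δ - β) (-1) with hb | hb
  · obtain rfl : β = 1 := by
      by_contra h1
      obtain rfl : β = 0 := by omega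
      push_cast at hb
      linarith
    rw [show 2 * δ - (1 : ℕ) = -1 by push_cast at hb ⊢; linarith]
    exact (lebesgueUnbounded_of_eq_neg_one hα hc).symm
  have hab : ¬ |2 * γ - α - (2 * δ - β)| ≤ 2 := fun hab => h ⟨⟨ha, ha2⟩, ⟨hb, hb2⟩, hab⟩
  rw [not_le, lt_abs] at hab
  rcases hab with hab | hab
  · obtain rfl : β = 1 := by
      by_contra h1
      obtain rfl : β = 0 := by omega
      push_cast at hab
      linarith
    exact lebesgueUnbounded_of_two_lt_sub hα hc hb.le (by linarith) hab
  · obtain rfl : α = 1 := by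
      by_contra h1
      obtain rfl : α = 0 := by omega
      push_cast at hab
      linarith
    exact (lebesgueUnbounded_of_two_lt_sub hβ hc ha.le (by linarith) (by linarith)).symm

theorem IsChebSystem.supLebesgueConst_lt_top_iff {α β : ℕ} {w : ℝ → ℝ} {P : ℕ → ℝ[X]}
    (h : IsChebSystem α β w P) {γ δ c : ℝ} (hγ : 0 ≤ γ) (hδ : 0 ≤ δ) (hc : 1 < c) :
    supLebesgueConst w (jacobiWeight γ δ) c < ⊤ ↔
      (-1 < 2 * γ - α ∧ 2 * γ - α ≤ 2) ∧ (-1 < 2 * δ - β ∧ 2 * δ - β ≤ 2) ∧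
      |2 * γ - α - (2 * δ - β)| ≤ 2 := by
  refine ⟨fun hlt => ?_, fun ⟨⟨ha, ha2⟩, ⟨hb, hb2⟩, hab⟩ =>
    h.supLebesgueConst_lt_top hγ hδ hc ha ha2 hb hb2 hab⟩
  by_contra hcon
  exact h.not_supLebesgueConst_lt_top
    (lebesgueUnbounded_of_not h.alpha_le h.beta_le hγ hδ hc hcon) hlt

theorem theorem1 (γ δ : ℝ) (hγ : 0 ≤ γ) (hδ : 0 ≤ δ) (c : ℝ) (hc : 1 < c) :
    (supLebesgueConst chebW1 (jacobiWeight γ δ) c < ⊤ ↔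
      (0 ≤ γ ∧ γ ≤ 1) ∧ (0 ≤ δ ∧ δ ≤ 1)) ∧
    (supLebesgueConst chebW2 (jacobiWeight γ δ) c < ⊤ ↔
      (0 < γ ∧ γ ≤ 3 / 2) ∧ (0 < δ ∧ δ ≤ 3 / 2) ∧ (-1 ≤ γ - δ ∧ γ - δ ≤ 1)) ∧
    (supLebesgueConst chebW3 (jacobiWeight γ δ) c < ⊤ ↔
      (0 ≤ γ ∧ γ ≤ 1) ∧ (0 < δ ∧ δ ≤ 3 / 2) ∧ γ - δ ≤ 1 / 2) ∧
    (supLebesgueConst chebW4 (jacobiWeight γ δ) c < ⊤ ↔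
      (0 < γ ∧ γ ≤ 3 / 2) ∧ (0 ≤ δ ∧ δ ≤ 1) ∧ -1 / 2 ≤ γ - δ) := by
  obtain ⟨_, h1⟩ := exists_isChebSystem_one
  obtain ⟨_, h2⟩ := exists_isChebSystem_two
  obtain ⟨_, h3⟩ := exists_isChebSystem_three
  obtain ⟨_, h4⟩ := exists_isChebSystem_four
  rw [h1.supLebesgueConst_lt_top_iff hγ hδ hc, h2.supLebesgueConst_lt_top_iff hγ hδ hc,
    h3.supLebesgueConst_lt_top_iff hγ hδ hc, h4.supLebesgueConst_lt_top_iff hγ hδ hc]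
  simp only [abs_le]
  push_cast
  refine ⟨⟨?_, ?_⟩, ⟨?_, ?_⟩, ⟨?_, ?_⟩, ⟨?_, ?_⟩⟩
  · rintro ⟨⟨_, _⟩, ⟨_, _⟩, _, _⟩
    refine ⟨⟨?_, ?_⟩, ?_, ?_⟩ <;> linarith
  · rintro ⟨⟨_, _⟩, _, _⟩
    refine ⟨⟨?_, ?_⟩, ⟨?_, ?_⟩, ?_, ?_⟩ <;> linarith
  · rintro ⟨⟨_, _⟩, ⟨_, _⟩, _, _⟩
    refine ⟨⟨?_, ?_⟩, ⟨?_, ?_⟩, ?_, ?_⟩ <;> linarith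
  · rintro ⟨⟨_, _⟩, ⟨_, _⟩, _, _⟩
    refine ⟨⟨?_, ?_⟩, ⟨?_, ?_⟩, ?_, ?_⟩ <;> linarith
  · rintro ⟨⟨_, _⟩, ⟨_, _⟩, _, _⟩
    refine ⟨⟨?_, ?_⟩, ⟨?_, ?_⟩, ?_⟩ <;> linarith
  · rintro ⟨⟨_, _⟩, ⟨_, _⟩, _⟩
    refine ⟨⟨?_, ?_⟩, ⟨?_, ?_⟩, ?_, ?_⟩ <;> linarith
  · rintro ⟨⟨_, _⟩, ⟨_, _⟩, _, _⟩
    refine ⟨⟨?_, ?_⟩, ⟨?_, ?_⟩, ?_⟩ <;> linarith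
  · rintro ⟨⟨_, _⟩, ⟨_, _⟩, _⟩
    refine ⟨⟨?_, ?_⟩, ⟨?_, ?_⟩, ?_, ?_⟩ <;> linarith
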